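/- Let $G(x)=\sin(2\pi x)$, $f_1(h)=h^{-6}-h^{-3}$, and let $f(h,x)=f_1(h)+\rho f_2(h)G(x)$ with either $f_2(h)=h^{-6}$ (the disjoining pressure $\Pi_{\rm SR}=h^{-6}(1+\rho G)-h^{-3}$) or $f_2(h)=-h^{-3}$ (the disjoining pressure $\Pi_{\rm LR}=h^{-6}-h^{-3}(1+\rho G)$). For $\epsilon>0$, $\bar h\in\mathbb R$ and $\rho\in\mathbb R$, a steady state is a positive $1$-periodic function $h\in C^2(\mathbb R)$ with $$\epsilon^2h''+f(h,x)-\int_0^1 f(h,x)\,dx=0,\qquad \int_0^1h\,dx=\bar h .$$ Let $h_0$ be a steady state for $\rho=0$ whose translates $h_{0,s}(x):=h_0(x+s)$, $s\in[0,1)$, are pairwise distinct; that is, $1$ is the minimal period of $h_0$ (in particular $h_0$ is not constant). All the $h_{0,s}$ are then steady states for $\rho=0$. For $1$-periodic $u\in C^2(\mathbb R)$ with $\int_0^1u\,dx=0$ put $$K_su:=\epsilon^2u''+f_1'(h_{0,s})u-\int_0^1f_1'(h_{0,s})u\,dx .$$ The first-order problem at $s$, obtained by inserting $h=h_{0,s}+\rho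 u+O(\rho^2)$ and collecting the terms of order $\rho$, is to find such a $u$ with $$K_su=-f_2(h_{0,s})G+\int_0^1f_2(h_{0,s})G\,dx .$$ 1. If the first-order problem at $s$ has a solution, then $\int_0^1f_2(h_{0,s})\,h_{0,s}'\,G\,dx=0$ (the solvability condition). 2. The solvability condition holds for exactly two shifts $s\in[0,1)$, say $s_1\ne s_2$. 3. No other point of the orbit persists: if $\rho_n\to0$, $\rho_n\neq0$, and steady states $h_n$ for $\rho=\rho_n$ (with the same $\epsilon$, $\bar h$) converge uniformly to $h_{0,s}$ with $s\in[0,1)$, then $s\in\{s_1,s_2\}$. 4. Suppose in addition that $h_0$ is nondegenerate, i.e. that $K_0u=0$ (with $u$ in the above domain) only for the multiples $u$ of $h_0'$. Then, for $s\in[0,1)$, the first-order problem at $s$ is solvable if and only if $s\in\{s_1,s_2\}$, and exactly two steady states of the orbit persist: there are solutions $u_i$ of the first-order problem at $s_i$ $(i=1,2)$ and constants $\delta,\rho_0>0$ and $C$ such that for every $\rho$ with $0<|\rho|<\rho_0$ there are exactly two steady states whose uniform distance to some translate of $h_0$ is at most $\delta$, and these two, $h^{(1)}_\rho\neq h^{(2)}_\rho$,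 satisfy $$\sup_x\bigl|h^{(i)}_\rho(x)-h_{0,s_i}(x)-\rho\,u_i(x)\bigr|\le C\rho^2\qquad(i=1,2).$$ -/

import Mathlib

open scoped Topology

noncomputable section

namespace ThinFilm

/-- The substrate pattern `G(x) = sin (2πx)`. -/
def G (x : ℝ) : ℝ := Real.sin (2 * Real.pi * x)

/-- Which of the two interaction terms feels the substrate pattern. -/
inductive Range where
  | LR
  | SR

/-- The disjoining pressure with wettability contrast `ρ`, as a function of the film thickness `h`
and the position `x`. -/
def disjoiningPressure : Range → ℝ → ℝ → ℝ → ℝ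
  | .LR, ρ, h, x => 1 / h ^ 6 - 1 / h ^ 3 * (1 + ρ * G x)
  | .SR, ρ, h, x => 1 / h ^ 6 * (1 + ρ * G x) - 1 / h ^ 3

/-- The spatially homogeneous part of the disjoining pressure. -/
def f₁ (h : ℝ) : ℝ := 1 / h ^ 6 - 1 / h ^ 3

/-- The coefficient of `ρ * G x` in the disjoining pressure. -/
def f₂ : Range → ℝ → ℝ
  | .LR, h => -(1 / h ^ 3)
  | .SR, h => 1 / h ^ 6

theorem disjoiningPressure_eq (r : Range) (ρ h x : ℝ) :
    disjoiningPressure r ρ h x = f₁ h + ρ * f₂ r h * G x := by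
  cases r <;> simp only [disjoiningPressure, f₁, f₂] <;> ring

/-- Positive `1`-periodic classical steady states of mean thickness `hbar`. -/
structure IsSteadyState (r : Range) (ε hbar ρ : ℝ) (h : ℝ → ℝ) : Prop where
  contDiff : ContDiff ℝ 2 h
  periodic : Function.Periodic h 1
  pos : ∀ x, 0 < h x
  equation : ∀ x, ε ^ 2 * deriv (deriv h) x + disjoiningPressure r ρ (h x) x
    - ∫ y in (0 : ℝ)..1, disjoiningPressure r ρ (h y) y = 0
  mean : ∫ x in (0 : ℝ)..1, h x = hbar

/-- The translate `x ↦ h₀ (x + s)`. -/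
def shift (h₀ : ℝ → ℝ) (s : ℝ) : ℝ → ℝ := fun x => h₀ (x + s)

/-- The domain of the linearisation: `C²`, `1`-periodic and (as perturbations preserve the volume)
of zero mean. -/
structure InDomain (u : ℝ → ℝ) : Prop where
  contDiff : ContDiff ℝ 2 u
  periodic : Function.Periodic u 1
  mean : ∫ x in (0 : ℝ)..1, u x = 0

/-- The linearisation at `h` of the steady state equation with `ρ = 0`, applied to `u`. -/
def K (ε : ℝ) (h u : ℝ → ℝ) (x : ℝ) : ℝ :=
  ε ^ 2 * deriv (deriv u) x + deriv f₁ (h x) * u x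
    - ∫ y in (0 : ℝ)..1, deriv f₁ (h y) * u y

/-- `u` solves the problem obtained from the terms of order `ρ` when `h + ρ u + O(ρ²)` is
substituted into the steady state problem. -/
def IsFirstOrderSolution (r : Range) (ε : ℝ) (h u : ℝ → ℝ) : Prop :=
  InDomain u ∧ ∀ x, K ε h u x =
    -(f₂ r (h x) * G x) + ∫ y in (0 : ℝ)..1, f₂ r (h y) * G y

/-- The first-order solvability condition at the steady state `h`. -/
def SolvabilityCondition (r : Range) (h : ℝ → ℝ) : Prop :=
  ∫ x in (0 : ℝ)..1, f₂ r (h x) * deriv h x * G x = 0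

/-- The kernel of the linearisation at `h` holds nothing but the multiples of `h'`, the direction
tangent to the translation orbit of `h`. -/
def Nondegenerate (ε : ℝ) (h : ℝ → ℝ) : Prop :=
  ∀ u, InDomain u → (∀ x, K ε h u x = 0) → ∃ c : ℝ, ∀ x, u x = c * deriv h x

/-- `h` is uniformly `δ`-close to some point of the translation orbit of `h₀`. -/
def NearOrbit (h₀ : ℝ → ℝ) (δ : ℝ) (h : ℝ → ℝ) : Prop :=
  ∃ s : ℝ, ∀ x, |h x - shift h₀ s x| ≤ δ

end ThinFilm

end

/-! Multiplying the steady state equation by `h'` and integrating over a period kills every term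
except `ρ ∫ f₂(h) h' G`. So for `ρ ≠ 0` a steady state satisfies the solvability condition exactly,
not just to first order. Integrated by parts, the condition reads `∫ F₂(h) cos(2πx) = 0`; no
derivative of `h` is left, so it survives uniform limits
(`solvabilityCondition_of_tendstoUniformly`). Testing the first-order problem with `h'` gives its
necessity there too.

Along the orbit the condition is explicit (`exists_solvability_sinusoid`). By ODE uniqueness `h₀` is
even about each critical point. Two reflections compose to a translation by twice the distance of
their centres, so minimal period `1` forbids critical points strictly within half a period after a
maximum `x₀`. Hence `f₂(h₀) h₀'` is odd about `x₀` with one sign on that half period, its first sine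
coefficient `a` is nonzero, and the functional equals `a cos(2π(s - x₀))`: two zeros per period,
both simple.

For persistence (`exists_unique_branch`) the equation is inverted to `w = hbar - ε⁻²
green(pressure)`, whose linearisation has the kernel direction `h'`. Subtracting `obstruction(w) •
e`, with `e = green h'`, removes this kernel: testing with `h'` shows the coefficient of `e`
vanishes, nondegeneracy leaves multiples of `h'`, and simplicity of the zero excludes those. The
linearisation is identity plus compact, hence invertible, and the implicit function theorem gives
one smooth branch. For `ρ ≠ 0` the added term vanishes on steady states by the exact identity;
conversely the energy identity forces it to vanish on the branch. A compactness argument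
(`exists_tube`) confines all steady states near the orbit to the two neighbourhoods where the branch
is unique. -/

noncomputable section

namespace ThinFilm

/-! ### Periodic functions on the circle and the compact Green operator of `u''` -/

/-- Continuous `1`-periodic functions, as the Banach algebra of continuous maps on the circle. -/
abbrev PeriodicMap := C(UnitAddCircle, ℝ)

namespace PeriodicMap

/-- The element of `PeriodicMap` given by a continuous `1`-periodic function on the line. -/
def ofPeriodic (f : ℝ → ℝ) (hf : Continuous f) (hp : Function.Periodic f 1) : PeriodicMap :=
  ⟨hp.lift, continuous_coinduced_dom.mpr hf⟩

@[simp]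
theorem ofPeriodic_coe {f : ℝ → ℝ} (hf : Continuous f) (hp : Function.Periodic f 1) (x : ℝ) :
    ofPeriodic f hf hp (x : UnitAddCircle) = f x :=
  rfl

theorem ext_coe {g k : PeriodicMap} (h : ∀ x : ℝ, g x = k x) : g = k := by
  ext x
  induction x using QuotientAddGroup.induction_on with
  | H x => exact h x

theorem continuous_line (g : PeriodicMap) : Continuous fun x : ℝ => g x :=
  g.continuous.comp (AddCircle.continuous_mk' 1)

theorem periodic_line (g : PeriodicMap) : Function.Periodic (fun x : ℝ => g x) 1 := by
  intro x
  simp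

theorem norm_le_iff {g : PeriodicMap} {C : ℝ} (hC : 0 ≤ C) :
    ‖g‖ ≤ C ↔ ∀ x : ℝ, |g x| ≤ C := by
  rw [ContinuousMap.norm_le _ hC]
  refine ⟨fun h x => h x, fun h x => ?_⟩
  induction x using QuotientAddGroup.induction_on with
  | H x => exact h x

theorem abs_coe_le (g : PeriodicMap) (x : ℝ) : |g x| ≤ ‖g‖ :=
  g.norm_coe_le_norm x

/-- The mean value over one period. -/
def mean : PeriodicMap →L[ℝ] ℝ :=
  LinearMap.mkContinuous
    { toFun := fun g => ∫ x in (0 : ℝ)..1, g x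
      map_add' := fun g k => by
        simpa using intervalIntegral.integral_add (g.continuous_line.intervalIntegrable _ _)
          (k.continuous_line.intervalIntegrable _ _)
      map_smul' := fun c g => by simp }
    1 fun g => by
      simpa using intervalIntegral.norm_integral_le_of_norm_le_const (a := (0 : ℝ)) (b := 1)
        (f := fun x : ℝ => g x) (C := ‖g‖) fun x _ => g.abs_coe_le x

theorem mean_apply (g : PeriodicMap) : mean g = ∫ x in (0 : ℝ)..1, g x := rfl

theorem mean_one : mean 1 = 1 := by
  simp [mean_apply]

theorem hasDerivAt_integral_sub_mean (g : PeriodicMap) (x : ℝ) :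
    HasDerivAt (fun x : ℝ => ∫ y in (0 : ℝ)..x, (g y - mean g)) (g x - mean g) x := by
  have hc : Continuous fun y : ℝ => g y - mean g := g.continuous_line.sub continuous_const
  exact intervalIntegral.integral_hasDerivAt_right (hc.intervalIntegrable _ _)
    (hc.stronglyMeasurableAtFilter _ _) hc.continuousAt

theorem periodic_integral_sub_mean (g : PeriodicMap) :
    Function.Periodic (fun x : ℝ => ∫ y in (0 : ℝ)..x, (g y - mean g)) 1 := by
  intro x
  have hc : Continuous fun y : ℝ => g y - mean g := g.continuous_line.sub continuous_const
  have hp : Function.Periodic (fun y : ℝ => g y - mean g) 1 := fun y => by simp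
  have h0 : ∫ y in (0 : ℝ)..1, (g y - mean g) = 0 := by
    rw [intervalIntegral.integral_sub (g.continuous_line.intervalIntegrable _ _) (by simp)]
    simp [mean_apply]
  have h1 := hp.intervalIntegral_add_eq x 0
  have h2 := intervalIntegral.integral_add_adjacent_intervals (hc.intervalIntegrable 0 x)
    (hc.intervalIntegrable x (x + 1)) (μ := MeasureTheory.volume)
  rw [zero_add, h0] at h1
  simp only
  rw [← h2, h1, add_zero]

/-- The primitive, vanishing at the origin, of the mean-free part. -/
def primitive : PeriodicMap →L[ℝ] PeriodicMap :=
  LinearMap.mkContinuous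
    { toFun := fun g => ofPeriodic (fun x => ∫ y in (0 : ℝ)..x, (g y - mean g))
        (continuous_iff_continuousAt.mpr fun x =>
          (hasDerivAt_integral_sub_mean g x).continuousAt) (periodic_integral_sub_mean g)
      map_add' := fun g k => ext_coe fun x => by
        have hg : Continuous fun y : ℝ => g y - mean g := g.continuous_line.sub continuous_const
        have hk : Continuous fun y : ℝ => k y - mean k := k.continuous_line.sub continuous_const
        simp only [ofPeriodic_coe, ContinuousMap.add_apply, map_add]
        rw [← intervalIntegral.integral_add (hg.intervalIntegrable _ _)
          (hk.intervalIntegrable _ _)]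
        exact intervalIntegral.integral_congr fun y _ => by ring
      map_smul' := fun c g => ext_coe fun x => by
        simp only [ofPeriodic_coe, ContinuousMap.smul_apply, map_smul, smul_eq_mul,
          RingHom.id_apply]
        rw [← intervalIntegral.integral_const_mul]
        exact intervalIntegral.integral_congr fun y _ => by ring }
    (1 + ‖mean‖) fun g => by
      refine (norm_le_iff (by positivity)).mpr fun x => ?_
      -- By periodicity one period suffices, where the interval of integration has length at most
      -- `1`.
      have key : ∀ x ∈ Set.Ico (0 : ℝ) 1,
          |∫ y in (0 : ℝ)..x, (g y - mean g)| ≤ (1 + ‖mean‖) * ‖g‖ := by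
        intro x hx
        have := intervalIntegral.norm_integral_le_of_norm_le_const (a := (0 : ℝ)) (b := x)
          (f := fun y : ℝ => g y - mean g) (C := (1 + ‖mean‖) * ‖g‖) fun y _ => by
            have h1 := g.abs_coe_le y
            have h2 := mean.le_opNorm g
            calc ‖g y - mean g‖ ≤ ‖g y‖ + ‖mean g‖ := norm_sub_le _ _
              _ ≤ ‖g‖ + ‖mean‖ * ‖g‖ := add_le_add h1 h2
              _ = _ := by ring
        rw [sub_zero, abs_of_nonneg hx.1] at this
        exact this.trans (mul_le_of_le_one_right (by positivity) hx.2.le)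
      obtain ⟨y, hy, hxy⟩ := (periodic_integral_sub_mean g).exists_mem_Ico₀ one_pos x
      simp only [LinearMap.coe_mk, AddHom.coe_mk, ofPeriodic_coe]
      rw [hxy]
      exact key y hy

theorem primitive_coe (g : PeriodicMap) (x : ℝ) :
    primitive g x = ∫ y in (0 : ℝ)..x, (g y - mean g) := rfl

/-- The mean-free primitive of the mean-free part. -/
def meanFreePrimitive : PeriodicMap →L[ℝ] PeriodicMap :=
  primitive - (mean.comp primitive).smulRight 1

theorem meanFreePrimitive_apply (g : PeriodicMap) :
    meanFreePrimitive g = primitive g - mean (primitive g) • (1 : PeriodicMap) := rfl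

theorem mean_meanFreePrimitive (g : PeriodicMap) : mean (meanFreePrimitive g) = 0 := by
  simp [meanFreePrimitive_apply, mean_one]

theorem hasDerivAt_meanFreePrimitive (g : PeriodicMap) (x : ℝ) :
    HasDerivAt (fun x : ℝ => meanFreePrimitive g x) (g x - mean g) x := by
  have h := (hasDerivAt_integral_sub_mean g x).sub_const (mean (primitive g))
  refine h.congr_of_eventuallyEq (.of_forall fun y => ?_)
  simp [meanFreePrimitive_apply, primitive_coe]

/-- Arzelà–Ascoli: the image of the unit ball is bounded, and equi-Lipschitz with constant `1 +
‖mean‖` because the derivative is `g - mean g`. -/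
theorem isCompactOperator_meanFreePrimitive : IsCompactOperator meanFreePrimitive := by
  let e := ContinuousMap.linearIsometryBoundedOfCompact UnitAddCircle ℝ ℝ
  let A := (fun g => e (meanFreePrimitive g)) '' Metric.closedBall (0 : PeriodicMap) 1
  have hA : IsCompact (closure A) := by
    refine BoundedContinuousFunction.arzela_ascoli
      (Set.Icc (-‖meanFreePrimitive‖) ‖meanFreePrimitive‖) isCompact_Icc A ?_ ?_
    · rintro _ x ⟨g, hg, rfl⟩
      have h1 : ‖meanFreePrimitive g‖ ≤ ‖meanFreePrimitive‖ := by
        have := meanFreePrimitive.le_opNorm g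
        have hg' : ‖g‖ ≤ 1 := by simpa using hg
        exact this.trans (mul_le_of_le_one_right (norm_nonneg _) hg')
      exact abs_le.mp (((meanFreePrimitive g).norm_coe_le_norm x).trans h1)
    · intro x₀
      induction x₀ using QuotientAddGroup.induction_on with
      | H x₀ =>
      rw [Metric.equicontinuousAt_iff_right]
      intro δ hδ
      -- Neighbourhoods on the circle are images of neighbourhoods on the line, so equicontinuity
      -- can be checked with real derivatives.
      have hmap : 𝓝 (x₀ : UnitAddCircle) = Filter.map ((↑) : ℝ → UnitAddCircle) (𝓝 x₀) :=
        (QuotientAddGroup.isOpenMap_coe.map_nhds_eq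
          QuotientAddGroup.continuous_mk.continuousAt).symm
      change ∀ᶠ x in 𝓝 (x₀ : UnitAddCircle), _
      rw [hmap, Filter.eventually_map]
      have hM : 0 < 1 + ‖mean‖ := by positivity
      filter_upwards [Metric.ball_mem_nhds x₀ (div_pos hδ hM)] with x hx
      rintro ⟨_, g, hg, rfl⟩
      have hg' : ‖g‖ ≤ 1 := by simpa using hg
      have hL := convex_univ.norm_image_sub_le_of_norm_hasDerivWithin_le
        (f := fun x : ℝ => meanFreePrimitive g x) (C := 1 + ‖mean‖) (x := x₀) (y := x)
        (fun y _ => (hasDerivAt_meanFreePrimitive g y).hasDerivWithinAt)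
        (fun y _ => by
          have h1 := g.abs_coe_le y
          have h2 := mean.le_opNorm g
          calc ‖g y - mean g‖ ≤ ‖g y‖ + ‖mean g‖ := norm_sub_le _ _
            _ ≤ ‖g‖ + ‖mean‖ * ‖g‖ := add_le_add h1 h2
            _ ≤ 1 + ‖mean‖ * 1 := by gcongr
            _ = _ := by ring) trivial trivial
      rw [Metric.mem_ball, dist_eq_norm, lt_div_iff₀ hM] at hx
      change dist (meanFreePrimitive g x₀) (meanFreePrimitive g x) < δ
      rw [dist_comm, dist_eq_norm]
      linarith [hL]
  refine ⟨e.symm '' closure A, hA.image e.symm.continuous, ?_⟩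
  filter_upwards [Metric.closedBall_mem_nhds (0 : PeriodicMap) one_pos] with g hg
  exact ⟨e (meanFreePrimitive g), subset_closure ⟨g, hg, rfl⟩, e.symm_apply_apply _⟩

/-- The mean-free periodic solution `u` of `u'' = g - mean g`. -/
def green : PeriodicMap →L[ℝ] PeriodicMap := meanFreePrimitive.comp meanFreePrimitive

theorem isCompactOperator_green : IsCompactOperator green :=
  isCompactOperator_meanFreePrimitive.comp_clm meanFreePrimitive

theorem mean_green (g : PeriodicMap) : mean (green g) = 0 :=
  mean_meanFreePrimitive _

theorem hasDerivAt_green (g : PeriodicMap) (x : ℝ) :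
    HasDerivAt (fun x : ℝ => green g x) (meanFreePrimitive g x) x := by
  simpa [green, mean_meanFreePrimitive] using
    hasDerivAt_meanFreePrimitive (meanFreePrimitive g) x

theorem deriv_green (g : PeriodicMap) :
    deriv (fun x : ℝ => green g x) = fun x : ℝ => meanFreePrimitive g x :=
  funext fun x => (hasDerivAt_green g x).deriv

theorem deriv_deriv_green (g : PeriodicMap) (x : ℝ) :
    deriv (deriv fun x : ℝ => green g x) x = g x - mean g := by
  rw [deriv_green]
  exact (hasDerivAt_meanFreePrimitive g x).deriv

theorem contDiff_two_of_hasDerivAt {u u' u'' : ℝ → ℝ} (h : ∀ x, HasDerivAt u (u' x) x)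
    (h' : ∀ x, HasDerivAt u' (u'' x) x) (hc : Continuous u'') : ContDiff ℝ 2 u := by
  have e : deriv u = u' := funext fun x => (h x).deriv
  have e' : deriv u' = u'' := funext fun x => (h' x).deriv
  rw [show (2 : WithTop ℕ∞) = 1 + 1 by norm_num, contDiff_succ_iff_deriv]
  refine ⟨fun x => (h x).differentiableAt, by simp, ?_⟩
  rw [e, contDiff_one_iff_deriv, e']
  exact ⟨fun x => (h' x).differentiableAt, hc⟩

theorem contDiff_green (g : PeriodicMap) : ContDiff ℝ 2 fun x : ℝ => green g x :=
  contDiff_two_of_hasDerivAt (hasDerivAt_green g) (hasDerivAt_meanFreePrimitive g)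
    (g.continuous_line.sub continuous_const)

end PeriodicMap

/-! ### Calculus of periodic `C²` functions -/

theorem hasDerivAt_of_contDiff_two {u : ℝ → ℝ} (hu : ContDiff ℝ 2 u) (x : ℝ) :
    HasDerivAt u (deriv u x) x :=
  (hu.differentiable two_ne_zero x).hasDerivAt

theorem contDiff_one_deriv {u : ℝ → ℝ} (hu : ContDiff ℝ 2 u) : ContDiff ℝ 1 (deriv u) := by
  rw [show (2 : WithTop ℕ∞) = 1 + 1 by norm_num, contDiff_succ_iff_deriv] at hu
  exact hu.2.2

theorem hasDerivAt_deriv_of_contDiff_two {u : ℝ → ℝ} (hu : ContDiff ℝ 2 u) (x : ℝ) :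
    HasDerivAt (deriv u) (deriv (deriv u) x) x :=
  ((contDiff_one_deriv hu).differentiable one_ne_zero x).hasDerivAt

theorem continuous_deriv_deriv {u : ℝ → ℝ} (hu : ContDiff ℝ 2 u) :
    Continuous (deriv (deriv u)) :=
  (contDiff_one_deriv hu).continuous_deriv le_rfl

theorem periodic_deriv {u : ℝ → ℝ} (hu : Function.Periodic u 1) :
    Function.Periodic (deriv u) 1 := by
  intro x
  rw [← deriv_comp_add_const]
  congr 1
  exact funext hu

/-- The integral of a derivative over a full period vanishes. -/
theorem integral_deriv_periodic {u u' : ℝ → ℝ} (hu : Function.Periodic u 1)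
    (h : ∀ x, HasDerivAt u (u' x) x) (hc : Continuous u') : ∫ x in (0 : ℝ)..1, u' x = 0 := by
  rw [intervalIntegral.integral_eq_sub_of_hasDerivAt (fun x _ => h x)
    (hc.intervalIntegrable _ _)]
  simpa using sub_eq_zero.mpr (hu 0)

theorem integral_mul_deriv_periodic {u u' v v' : ℝ → ℝ} (hu : Function.Periodic u 1)
    (hv : Function.Periodic v 1) (du : ∀ x, HasDerivAt u (u' x) x)
    (dv : ∀ x, HasDerivAt v (v' x) x) (cu : Continuous u') (cv : Continuous v') :
    ∫ x in (0 : ℝ)..1, u x * v' x = -∫ x in (0 : ℝ)..1, u' x * v x := by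
  rw [intervalIntegral.integral_mul_deriv_eq_deriv_mul (fun x _ => du x) (fun x _ => dv x)
    (cu.intervalIntegrable _ _) (cv.intervalIntegrable _ _)]
  have h1 : u 1 = u 0 := by simpa using hu 0
  have h2 : v 1 = v 0 := by simpa using hv 0
  rw [h1, h2]
  ring

/-- A periodic function is determined by its mean and its second derivative. -/
theorem PeriodicMap.eq_mean_add_green {u : ℝ → ℝ} (hu : ContDiff ℝ 2 u)
    (hp : Function.Periodic u 1) {g : PeriodicMap}
    (h : ∀ x : ℝ, deriv (deriv u) x = g x - mean g) (x : ℝ) :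
    u x = (∫ y in (0 : ℝ)..1, u y) + green g x := by
  set d : ℝ → ℝ := fun x => u x - green g x with hd
  set d' : ℝ → ℝ := fun x => deriv u x - meanFreePrimitive g x with hd'
  have h1 : ∀ x, HasDerivAt d (d' x) x := fun x =>
    (hasDerivAt_of_contDiff_two hu x).sub (hasDerivAt_green g x)
  have h2 : ∀ x, HasDerivAt d' 0 x := fun x => by
    have := (hasDerivAt_deriv_of_contDiff_two hu x).sub (hasDerivAt_meanFreePrimitive g x)
    rwa [h x, sub_self] at this
  have hdp : Function.Periodic d 1 := fun x => by simp [hd, hp x]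
  have c2 : ∀ x, d' x = d' 0 := fun x =>
    is_const_of_deriv_eq_zero (fun x => (h2 x).differentiableAt) (fun x => (h2 x).deriv) x 0
  -- The derivative of the periodic difference is constant and integrates to zero over a period.
  have c3 : d' 0 = 0 := by
    have := integral_deriv_periodic hdp h1
      (continuous_iff_continuousAt.mpr fun x => (h2 x).continuousAt)
    rw [intervalIntegral.integral_congr fun x _ => c2 x] at this
    simpa using this
  have c1 : ∀ x, d x = d 0 := fun x =>
    is_const_of_deriv_eq_zero (fun x => (h1 x).differentiableAt)
      (fun x => by rw [(h1 x).deriv, c2, c3]) x 0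
  have c0 : ∫ y in (0 : ℝ)..1, d y = ∫ y in (0 : ℝ)..1, u y := by
    simp only [hd]
    rw [intervalIntegral.integral_sub (hu.continuous.intervalIntegrable _ _)
      ((green g).continuous_line.intervalIntegrable _ _), ← mean_apply, mean_green, sub_zero]
  rw [intervalIntegral.integral_congr fun x _ => c1 x] at c0
  simp only [intervalIntegral.integral_const, sub_zero, one_smul] at c0
  have := c1 x
  rw [← c0, ← this]
  simp [hd]

/-! ### Regularity of the nonlinearities away from zero thickness -/

theorem contDiffAt_f₁ {n : WithTop ℕ∞} {h : ℝ} (hh : h ≠ 0) : ContDiffAt ℝ n f₁ h := by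
  change ContDiffAt ℝ n (fun y : ℝ => 1 / y ^ 6 - 1 / y ^ 3) h
  have h6 := pow_ne_zero 6 hh
  have h3 := pow_ne_zero 3 hh
  fun_prop (disch := assumption)

theorem hasDerivAt_f₁ {h : ℝ} (hh : h ≠ 0) : HasDerivAt f₁ (deriv f₁ h) h :=
  ((contDiffAt_f₁ (n := 1) hh).differentiableAt one_ne_zero).hasDerivAt

theorem continuousAt_deriv_f₁ {h : ℝ} (hh : h ≠ 0) : ContinuousAt (deriv f₁) h := by
  have := ((contDiffAt_f₁ (n := 1) hh).fderiv_right (m := 0) le_rfl).continuousAt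
  exact this.clm_apply continuousAt_const

/-- An antiderivative of `f₂`. -/
def F₂ : Range → ℝ → ℝ
  | .LR, h => 2⁻¹ * h⁻¹ ^ 2
  | .SR, h => -5⁻¹ * h⁻¹ ^ 5

theorem hasDerivAt_F₂ (r : Range) {h : ℝ} (hh : h ≠ 0) : HasDerivAt (F₂ r) (f₂ r h) h := by
  cases r
  · have := ((hasDerivAt_inv hh).pow 2).const_mul (2⁻¹ : ℝ)
    convert! this using 1
    simp only [f₂]
    push_cast
    field_simp
  · have := ((hasDerivAt_inv hh).pow 5).const_mul (-5⁻¹ : ℝ)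
    convert! this using 1
    simp only [f₂]
    push_cast
    field_simp

theorem differentiableAt_f₂ (r : Range) {h : ℝ} (hh : h ≠ 0) : DifferentiableAt ℝ (f₂ r) h := by
  cases r
  · change DifferentiableAt ℝ (fun y : ℝ => -(1 / y ^ 3)) h
    have h3 := pow_ne_zero 3 hh
    fun_prop (disch := assumption)
  · change DifferentiableAt ℝ (fun y : ℝ => 1 / y ^ 6) h
    have h6 := pow_ne_zero 6 hh
    fun_prop (disch := assumption)

theorem f₂_ne_zero (r : Range) {h : ℝ} (hh : h ≠ 0) : f₂ r h ≠ 0 := by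
  cases r <;> simp [f₂, hh]

theorem continuous_deriv_f₁_comp {h : ℝ → ℝ} (hc : Continuous h) (hpos : ∀ x, 0 < h x) :
    Continuous fun x => deriv f₁ (h x) :=
  continuous_iff_continuousAt.mpr fun x =>
    (continuousAt_deriv_f₁ (hpos x).ne').comp hc.continuousAt

theorem continuous_f₂_comp (r : Range) {h : ℝ → ℝ} (hc : Continuous h) (hpos : ∀ x, 0 < h x) :
    Continuous fun x => f₂ r (h x) :=
  continuous_iff_continuousAt.mpr fun x =>
    (differentiableAt_f₂ r (hpos x).ne').continuousAt.comp hc.continuousAt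

/-! ### Symmetry of steady states and the sinusoidal solvability functional -/

/-- A positive periodic solution of `ε² h'' + f₁(h) = c` is even about each critical point. -/
theorem even_about_critical_point {ε c : ℝ} (hε : 0 < ε) {h : ℝ → ℝ} (hC : ContDiff ℝ 2 h)
    (hper : Function.Periodic h 1) (hpos : ∀ x, 0 < h x)
    (heq : ∀ x, ε ^ 2 * deriv (deriv h) x + f₁ (h x) = c) {x₀ : ℝ} (hx₀ : deriv h x₀ = 0)
    (t : ℝ) : h (x₀ + t) = h (x₀ - t) := by
  -- The values of `h` fill a compact interval away from `0`, on which the singular `f₁` is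
  -- Lipschitz.
  have hcpt := hper.compact_of_continuous one_ne_zero hC.continuous
  obtain ⟨m, hm, hml⟩ := hcpt.exists_isLeast (Set.range_nonempty h)
  obtain ⟨M, hM, hMu⟩ := hcpt.exists_isGreatest (Set.range_nonempty h)
  have hm0 : 0 < m := by
    obtain ⟨y, rfl⟩ := hm
    exact hpos y
  have hmem : ∀ x, h x ∈ Set.Icc m M := fun x =>
    ⟨hml (Set.mem_range_self x), hMu (Set.mem_range_self x)⟩
  have hne : ∀ y ∈ Set.Icc m M, y ≠ 0 := fun y hy => (hm0.trans_le hy.1).ne'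
  obtain ⟨B, hB⟩ := isCompact_Icc.exists_bound_of_continuousOn (s := Set.Icc m M)
    (f := deriv f₁) fun y hy => (continuousAt_deriv_f₁ (hne y hy)).continuousWithinAt
  have hlip : LipschitzOnWith B.toNNReal f₁ (Set.Icc m M) :=
    (convex_Icc m M).lipschitzOnWith_of_nnnorm_hasDerivWithin_le
      (fun y hy => (hasDerivAt_f₁ (hne y hy)).hasDerivWithinAt) fun y hy => by
        rw [← NNReal.coe_le_coe, coe_nnnorm]
        exact (hB y hy).trans (Real.le_coe_toNNReal B)
  let v : ℝ → ℝ × ℝ → ℝ × ℝ := fun _ p => (p.2, (ε ^ 2)⁻¹ * (c - f₁ p.1))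
  let S : ℝ → Set (ℝ × ℝ) := fun _ => {p | p.1 ∈ Set.Icc m M}
  have hv : ∀ τ, LipschitzOnWith (max 1 (‖(ε ^ 2)⁻¹‖₊ * B.toNNReal)) (v τ) (S τ) := by
    intro τ
    refine (LipschitzWith.prod_snd.lipschitzOnWith).prodMk ?_
    refine LipschitzOnWith.of_dist_le_mul fun p hp q hq => ?_
    have h1 := hlip.dist_le_mul p.1 hp q.1 hq
    have h2 : dist p.1 q.1 ≤ dist p q := le_max_left _ _
    rw [Real.dist_eq] at h1 ⊢
    rw [show (ε ^ 2)⁻¹ * (c - f₁ p.1) - (ε ^ 2)⁻¹ * (c - f₁ q.1)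
      = (ε ^ 2)⁻¹ * (-(f₁ p.1 - f₁ q.1)) by ring, abs_mul, abs_neg, NNReal.coe_mul, coe_nnnorm,
      Real.norm_eq_abs, mul_assoc]
    gcongr
    exact h1.trans (by gcongr)
  have hd : ∀ x, deriv (deriv h) x = (ε ^ 2)⁻¹ * (c - f₁ (h x)) := fun x => by
    rw [← heq x]
    field_simp
    ring
  have hd1 := hasDerivAt_of_contDiff_two hC
  have hd2 := hasDerivAt_deriv_of_contDiff_two hC
  -- The orbit and its reflection solve the same autonomous first-order system, with equal data at
  -- `τ = 0` since `h'(x₀) = 0`.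
  have huniq := ODE_solution_unique_univ (v := v) (s := S) (t₀ := 0)
    (f := fun τ => (h (x₀ + τ), deriv h (x₀ + τ))) (g := fun τ => (h (x₀ - τ), -deriv h (x₀ - τ)))
    hv
    (fun τ => ⟨by
      have := ((hd1 (x₀ + τ)).comp_const_add x₀ τ).prodMk ((hd2 (x₀ + τ)).comp_const_add x₀ τ)
      rw [hd] at this
      exact this, hmem _⟩)
    (fun τ => ⟨by
      have := ((hd1 (x₀ - τ)).comp_const_sub x₀ τ).prodMk
        ((hd2 (x₀ - τ)).comp_const_sub x₀ τ).neg
      rw [hd, neg_neg] at this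
      exact this, hmem _⟩)
    (by simp [hx₀])
  exact congrArg Prod.fst (congrFun huniq t)

/-- Integrals over a period are invariant under translation. -/
theorem integral_shift {k : ℝ → ℝ} (hk : Function.Periodic k 1) (s : ℝ) :
    ∫ x in (0 : ℝ)..1, k (x + s) = ∫ x in (0 : ℝ)..1, k x := by
  rw [intervalIntegral.integral_comp_add_right, zero_add, add_comm 1 s,
    hk.intervalIntegral_add_eq s 0, zero_add]

/-- Move the shift onto the trigonometric factor and apply the addition formula; the cosine
coefficient of an odd function vanishes, so only its sine coefficient remains. -/
theorem integral_odd_shift {g : ℝ → ℝ} (hg : Continuous g) (hp : Function.Periodic g 1)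
    (hodd : ∀ x, g (-x) = -g x) (σ : ℝ) :
    (∫ x in (0 : ℝ)..1, g (x + σ) * Real.sin (2 * Real.pi * x)
      = (∫ x in (0 : ℝ)..1, g x * Real.sin (2 * Real.pi * x)) * Real.cos (2 * Real.pi * σ)) ∧
    (∫ x in (0 : ℝ)..1, g (x + σ) * Real.cos (2 * Real.pi * x)
      = (∫ x in (0 : ℝ)..1, g x * Real.sin (2 * Real.pi * x)) * Real.sin (2 * Real.pi * σ)) := by
  have hs : Continuous fun x => g x * Real.sin (2 * Real.pi * x) := by fun_prop
  have hc : Continuous fun x => g x * Real.cos (2 * Real.pi * x) := by fun_prop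
  have hsi : ∀ c : ℝ, IntervalIntegrable (fun x => g x * Real.sin (2 * Real.pi * x) * c)
      MeasureTheory.volume 0 1 := fun c => (hs.mul continuous_const).intervalIntegrable _ _
  have hci : ∀ c : ℝ, IntervalIntegrable (fun x => g x * Real.cos (2 * Real.pi * x) * c)
      MeasureTheory.volume 0 1 := fun c => (hc.mul continuous_const).intervalIntegrable _ _
  have hcos0 : ∫ x in (0 : ℝ)..1, g x * Real.cos (2 * Real.pi * x) = 0 := by
    have h1 := intervalIntegral.integral_comp_sub_left (a := 0) (b := 1)
      (fun x => g x * Real.cos (2 * Real.pi * x)) 1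
    have h2 : ∀ x, g (1 - x) * Real.cos (2 * Real.pi * (1 - x))
        = -(g x * Real.cos (2 * Real.pi * x)) := fun x => by
      rw [show 1 - x = -x + 1 by ring, hp, hodd, show 2 * Real.pi * (-x + 1)
        = -(2 * Real.pi * x) + 2 * Real.pi by ring, Real.cos_add_two_pi, Real.cos_neg]
      ring
    simp only [h2, intervalIntegral.integral_neg, sub_zero, sub_self] at h1
    linarith
  constructor
  · have := integral_shift (s := σ) (k := fun x => g x * Real.sin (2 * Real.pi * (x - σ))) (fun x => by
      simp only
      rw [hp, show 2 * Real.pi * (x + 1 - σ) = 2 * Real.pi * (x - σ) + 2 * Real.pi by ring,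
        Real.sin_add_two_pi])
    simp only [add_sub_cancel_right] at this
    rw [this, ← intervalIntegral.integral_mul_const]
    have e : ∀ x, g x * Real.sin (2 * Real.pi * (x - σ))
        = g x * Real.sin (2 * Real.pi * x) * Real.cos (2 * Real.pi * σ)
          - g x * Real.cos (2 * Real.pi * x) * Real.sin (2 * Real.pi * σ) := fun x => by
      rw [mul_sub, Real.sin_sub]
      ring
    simp only [e]
    rw [intervalIntegral.integral_sub (hsi _) (hci _),
      intervalIntegral.integral_mul_const _ (fun x => g x * Real.cos _), hcos0]
    simp
  · have := integral_shift (s := σ) (k := fun x => g x * Real.cos (2 * Real.pi * (x - σ))) (fun x => by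
      simp only
      rw [hp, show 2 * Real.pi * (x + 1 - σ) = 2 * Real.pi * (x - σ) + 2 * Real.pi by ring,
        Real.cos_add_two_pi])
    simp only [add_sub_cancel_right] at this
    rw [this, ← intervalIntegral.integral_mul_const]
    have e : ∀ x, g x * Real.cos (2 * Real.pi * (x - σ))
        = g x * Real.cos (2 * Real.pi * x) * Real.cos (2 * Real.pi * σ)
          + g x * Real.sin (2 * Real.pi * x) * Real.sin (2 * Real.pi * σ) := fun x => by
      rw [mul_sub, Real.cos_sub]
      ring
    simp only [e]
    rw [intervalIntegral.integral_add (hci _) (hsi _),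
      intervalIntegral.integral_mul_const _ (fun x => g x * Real.cos _), hcos0]
    simp

/-- The integrand is symmetric under `x ↦ 1 - x`, so the integral is twice that over `(0, 1/2)`.
There the sine is positive and `g`, having no zero, keeps one sign. -/
theorem integral_odd_mul_sin_ne_zero {g : ℝ → ℝ} (hg : Continuous g)
    (hp : Function.Periodic g 1) (hodd : ∀ x, g (-x) = -g x)
    (hne : ∀ x ∈ Set.Ioo (0 : ℝ) (1 / 2), g x ≠ 0) :
    ∫ x in (0 : ℝ)..1, g x * Real.sin (2 * Real.pi * x) ≠ 0 := by
  set k : ℝ → ℝ := fun x => g x * Real.sin (2 * Real.pi * x) with hk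
  have hkc : Continuous k := by fun_prop
  have hsym : ∀ x, k (1 - x) = k x := fun x => by
    simp only [hk]
    rw [show 1 - x = -x + 1 by ring, hp, hodd, show 2 * Real.pi * (-x + 1)
      = -(2 * Real.pi * x) + 2 * Real.pi by ring, Real.sin_add_two_pi, Real.sin_neg]
    ring
  have hhalf : ∫ x in (1 / 2 : ℝ)..1, k x = ∫ x in (0 : ℝ)..(1 / 2), k x := by
    have := intervalIntegral.integral_comp_sub_left (a := 1 / 2) (b := 1) k 1
    simp only [hsym] at this
    rw [this]
    norm_num
  rw [← intervalIntegral.integral_add_adjacent_intervals (hkc.intervalIntegrable 0 (1 / 2))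
    (hkc.intervalIntegrable _ _), hhalf, ← two_mul]
  refine mul_ne_zero two_ne_zero ?_
  have hsin : ∀ x ∈ Set.Ioo (0 : ℝ) (1 / 2), 0 < Real.sin (2 * Real.pi * x) := fun x hx =>
    Real.sin_pos_of_pos_of_lt_pi (by have := hx.1; positivity) (by
      have := hx.2
      nlinarith [Real.pi_pos])
  have hsign : (∀ x ∈ Set.Ioo (0 : ℝ) (1 / 2), 0 < g x) ∨
      ∀ x ∈ Set.Ioo (0 : ℝ) (1 / 2), g x < 0 := by
    by_contra! hcon
    obtain ⟨⟨x, hx, hgx⟩, y, hy, hgy⟩ := hcon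
    obtain ⟨z, hz, hgz⟩ := isPreconnected_Ioo.intermediate_value hx hy hg.continuousOn
      (Set.mem_Icc.mpr ⟨hgx, hgy⟩)
    exact hne z hz hgz
  rcases hsign with hs | hs
  · exact (intervalIntegral.intervalIntegral_pos_of_pos_on (hkc.intervalIntegrable _ _)
      (fun x hx => mul_pos (hs x hx) (hsin x hx)) (by norm_num)).ne'
  · have := intervalIntegral.intervalIntegral_pos_of_pos_on (f := fun x => -k x)
      (hkc.neg.intervalIntegrable 0 (1 / 2))
      (fun x hx => neg_pos.mpr (mul_neg_of_neg_of_pos (hs x hx) (hsin x hx))) (by norm_num)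
    rw [intervalIntegral.integral_neg, neg_pos] at this
    exact this.ne

theorem deriv_shift (h : ℝ → ℝ) (s x : ℝ) : deriv (shift h s) x = deriv h (x + s) :=
  deriv_comp_add_const h s x

theorem deriv_deriv_shift (h : ℝ → ℝ) (s x : ℝ) :
    deriv (deriv (shift h s)) x = deriv (deriv h) (x + s) := by
  rw [show deriv (shift h s) = shift (deriv h) s from funext (deriv_shift h s), deriv_shift]

theorem IsSteadyState.autonomous {r : Range} {ε hbar : ℝ} {h : ℝ → ℝ}
    (hh : IsSteadyState r ε hbar 0 h) (x : ℝ) :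
    ε ^ 2 * deriv (deriv h) x + f₁ (h x) = ∫ y in (0 : ℝ)..1, f₁ (h y) := by
  have := hh.equation x
  simp only [disjoiningPressure_eq, zero_mul, add_zero] at this
  linarith

theorem IsSteadyState.shift {r : Range} {ε hbar : ℝ} {h : ℝ → ℝ}
    (hh : IsSteadyState r ε hbar 0 h) (s : ℝ) : IsSteadyState r ε hbar 0 (shift h s) where
  contDiff := hh.contDiff.comp (contDiff_id.add contDiff_const)
  periodic x := by
    simp only [ThinFilm.shift]
    rw [add_right_comm, hh.periodic]
  pos x := hh.pos _
  equation x := by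
    rw [deriv_deriv_shift]
    simp only [disjoiningPressure_eq, zero_mul, add_zero, ThinFilm.shift]
    rw [integral_shift (k := fun y => f₁ (h y)) (hh.periodic.comp f₁), hh.autonomous, sub_self]
  mean := (integral_shift hh.periodic s).trans hh.mean

/-- The solvability functional along the translation orbit is a nonzero sinusoid. -/
theorem exists_solvability_sinusoid {r : Range} {ε hbar : ℝ} (hε : 0 < ε) {h₀ : ℝ → ℝ}
    (hh₀ : IsSteadyState r ε hbar 0 h₀)
    (horbit : ∀ s ∈ Set.Ioo (0 : ℝ) 1, shift h₀ s ≠ h₀) :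
    ∃ x₀ a : ℝ, a ≠ 0 ∧ ∀ s : ℝ,
      (∫ x in (0 : ℝ)..1, f₂ r (shift h₀ s x) * deriv (shift h₀ s) x * G x
        = a * Real.cos (2 * Real.pi * (s - x₀))) ∧
      (∫ x in (0 : ℝ)..1, f₂ r (shift h₀ s x) * deriv (shift h₀ s) x
        * Real.cos (2 * Real.pi * x) = a * Real.sin (2 * Real.pi * (s - x₀))) := by
  have hcpt := hh₀.periodic.compact_of_continuous one_ne_zero hh₀.contDiff.continuous
  obtain ⟨_, ⟨x₀, rfl⟩, hM⟩ := hcpt.exists_isGreatest (Set.range_nonempty h₀)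
  have hcrit : deriv h₀ x₀ = 0 :=
    IsLocalMax.deriv_eq_zero (Filter.Eventually.of_forall fun y => hM (Set.mem_range_self y))
  have heven : ∀ {x₁ : ℝ}, deriv h₀ x₁ = 0 → ∀ t, h₀ (x₁ + t) = h₀ (x₁ - t) := fun hx₁ t =>
    even_about_critical_point hε hh₀.contDiff hh₀.periodic hh₀.pos hh₀.autonomous hx₁ t
  have hnocrit : ∀ t ∈ Set.Ioo (0 : ℝ) (1 / 2), deriv h₀ (t + x₀) ≠ 0 := by
    intro t ht hzero
    -- Reflecting about `t + x₀` and then about `x₀` is a translation by `2 * t`, which lies in `(0,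
    -- 1)`.
    refine horbit (2 * t) ⟨by linarith [ht.1], by linarith [ht.2]⟩ (funext fun y => ?_)
    have h1 := heven hzero (y + t - x₀)
    have h2 := heven hcrit (y - x₀)
    rw [shift, show y + 2 * t = t + x₀ + (y + t - x₀) by ring, h1,
      show t + x₀ - (y + t - x₀) = x₀ - (y - x₀) by ring, ← h2]
    congr 1
    ring
  set g : ℝ → ℝ := fun x => f₂ r (h₀ (x + x₀)) * deriv h₀ (x + x₀) with hg
  have hd1 := hasDerivAt_of_contDiff_two hh₀.contDiff
  have hgc : Continuous g :=
    (continuous_f₂_comp r (h := fun x => h₀ (x + x₀))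
      (hh₀.contDiff.continuous.comp (by fun_prop)) fun x => hh₀.pos _).mul
      ((contDiff_one_deriv hh₀.contDiff).continuous.comp (by fun_prop))
  have hgp : Function.Periodic g 1 := fun x => by
    simp only [hg]
    rw [add_right_comm, hh₀.periodic, periodic_deriv hh₀.periodic]
  have hgodd : ∀ x, g (-x) = -g x := fun x => by
    have e1 := heven hcrit x
    have e2 : deriv h₀ (x₀ + x) = -deriv h₀ (x₀ - x) := by
      have d1 := (hd1 (x₀ + x)).comp_const_add x₀ x
      have d2 := (hd1 (x₀ - x)).comp_const_sub x₀ x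
      rw [show (fun t => h₀ (x₀ - t)) = fun t => h₀ (x₀ + t) from
        funext fun t => (heven hcrit t).symm] at d2
      exact d1.unique d2
    simp only [hg]
    rw [show -x + x₀ = x₀ - x by ring, add_comm x x₀, e2, e1]
    ring
  refine ⟨x₀, _, integral_odd_mul_sin_ne_zero hgc hgp hgodd fun x hx =>
    mul_ne_zero (f₂_ne_zero r (hh₀.pos _).ne') (hnocrit x hx), fun s => ?_⟩
  have := integral_odd_shift hgc hgp hgodd (s - x₀)
  have e : ∀ x, g (x + (s - x₀)) = f₂ r (shift h₀ s x) * deriv (shift h₀ s) x := fun x => by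
    rw [deriv_shift]
    simp only [hg, shift]
    rw [show x + (s - x₀) + x₀ = x + s by ring]
  simp only [e] at this
  exact this

/-- In each period the cosine vanishes at exactly two phases. -/
theorem exists_two_zeros_cos (x₀ : ℝ) :
    ∃ s₁ ∈ Set.Ico (0 : ℝ) 1, ∃ s₂ ∈ Set.Ico (0 : ℝ) 1, s₁ ≠ s₂ ∧
      ∀ s ∈ Set.Ico (0 : ℝ) 1, Real.cos (2 * Real.pi * (s - x₀)) = 0 ↔ s = s₁ ∨ s = s₂ := by
  have hmem : ∀ y : ℝ, Int.fract y ∈ Set.Ico (0 : ℝ) 1 := fun y =>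
    ⟨Int.fract_nonneg y, Int.fract_lt_one y⟩
  have hcos : ∀ s, Real.cos (2 * Real.pi * (s - x₀)) = 0 ↔ ∃ k : ℤ, s = x₀ + 1 / 4 + k / 2 := by
    intro s
    rw [Real.cos_eq_zero_iff]
    refine exists_congr fun k => ⟨fun h => ?_, fun h => ?_⟩
    · have hpi := Real.pi_ne_zero
      field_simp at h
      linarith
    · rw [h]
      ring
  have huniq : ∀ s ∈ Set.Ico (0 : ℝ) 1, ∀ y : ℝ, ∀ m : ℤ, s = y + m → s = Int.fract y := by
    intro s hs y m h
    rw [← Int.fract_eq_self.mpr hs, h, Int.fract_add_intCast]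
  -- The zeros are `x₀ + 1/4 + k/2`; modulo `1`, even `k` give the first representative and odd `k`
  -- the second.
  refine ⟨_, hmem (x₀ + 1 / 4), _, hmem (x₀ + 3 / 4), fun h => ?_, fun s hs => ?_⟩
  · obtain ⟨m, hm⟩ := Int.fract_eq_fract.mp h
    have h2 : (2 * m : ℝ) = -1 := by linarith
    have h3 : 2 * m = -1 := by exact_mod_cast h2
    omega
  · rw [hcos]
    constructor
    · rintro ⟨k, hk⟩
      rcases Int.even_or_odd' k with ⟨m, rfl | rfl⟩
      · exact Or.inl (huniq s hs _ m (by rw [hk]; push_cast; ring))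
      · exact Or.inr (huniq s hs _ m (by rw [hk]; push_cast; ring))
    · rintro (rfl | rfl)
      · exact ⟨-2 * ⌊x₀ + 1 / 4⌋, by rw [Int.fract]; push_cast; ring⟩
      · exact ⟨1 - 2 * ⌊x₀ + 3 / 4⌋, by rw [Int.fract]; push_cast; ring⟩

/-! ### Testing with the derivative: solvability and energy identities -/

theorem hasDerivAt_G (x : ℝ) :
    HasDerivAt G (2 * Real.pi * Real.cos (2 * Real.pi * x)) x := by
  have := ((hasDerivAt_id x).const_mul (2 * Real.pi)).sin
  rw [mul_one] at this
  exact this.congr_deriv (mul_comm _ _)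

theorem continuous_G : Continuous G := by
  unfold G
  fun_prop

theorem periodic_G : Function.Periodic G 1 := fun x => by
  rw [G, mul_add, mul_one, Real.sin_add_two_pi, G]

theorem continuous_cos_two_pi : Continuous fun x : ℝ => Real.cos (2 * Real.pi * x) := by
  fun_prop

theorem periodic_cos_two_pi : Function.Periodic (fun x : ℝ => Real.cos (2 * Real.pi * x)) 1 :=
  fun x => by simp only [mul_add, mul_one, Real.cos_add_two_pi]

theorem f₁_eq_add (h : ℝ) : f₁ h = f₂ .SR h + f₂ .LR h := by
  simp only [f₁, f₂]
  ring

/-- The derivative of a steady state spans the cokernel of the linearisation. -/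
theorem integral_K_mul_deriv {r : Range} {ε hbar : ℝ} {h u : ℝ → ℝ}
    (hh : IsSteadyState r ε hbar 0 h) (hu : InDomain u) :
    ∫ x in (0 : ℝ)..1, K ε h u x * deriv h x = 0 := by
  set c := ∫ y in (0 : ℝ)..1, f₁ (h y)
  have hd1 := hasDerivAt_of_contDiff_two hh.contDiff
  have hd2 := hasDerivAt_deriv_of_contDiff_two hh.contDiff
  have ud1 := hasDerivAt_of_contDiff_two hu.contDiff
  have ud2 := hasDerivAt_deriv_of_contDiff_two hu.contDiff
  -- The integrand is an exact derivative: `c - f₁(h) = ε² h''`, so the first two terms form the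
  -- Wronskian-type primitive of the self-adjoint local part.
  refine integral_deriv_periodic (u := fun x => ε ^ 2 * (deriv u x * deriv h x)
    - u x * (c - f₁ (h x)) - (∫ y in (0 : ℝ)..1, deriv f₁ (h y) * u y) * h x) ?_ ?_ ?_
  · intro x
    simp only [hu.periodic x, hh.periodic x, periodic_deriv hu.periodic x,
      periodic_deriv hh.periodic x]
  · intro x
    have hf := (hasDerivAt_f₁ (hh.pos x).ne').comp x (hd1 x)
    have := ((((ud2 x).mul (hd2 x)).const_mul (ε ^ 2)).sub
      ((ud1 x).mul (hf.const_sub c))).sub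
        ((hd1 x).const_mul (∫ y in (0 : ℝ)..1, deriv f₁ (h y) * u y))
    convert! this using 1
    have e := hh.autonomous x
    simp only [K, Function.comp_apply]
    linear_combination -deriv u x * e
  · have hK : Continuous (K ε h u) :=
      ((continuous_const.mul (continuous_deriv_deriv hu.contDiff)).add
        ((continuous_deriv_f₁_comp hh.contDiff.continuous hh.pos).mul
          hu.contDiff.continuous)).sub continuous_const
    exact hK.mul (contDiff_one_deriv hh.contDiff).continuous

theorem integral_deriv_eq_zero {h : ℝ → ℝ} (hC : ContDiff ℝ 2 h) (hp : Function.Periodic h 1) :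
    ∫ x in (0 : ℝ)..1, deriv h x = 0 :=
  integral_deriv_periodic hp (hasDerivAt_of_contDiff_two hC) (contDiff_one_deriv hC).continuous

/-- Pair the first-order equation with `h'`: the left side vanishes by `integral_K_mul_deriv`, and
the constant drops out because `h'` has mean zero. -/
theorem solvabilityCondition_of_isFirstOrderSolution {r : Range} {ε hbar : ℝ} {h u : ℝ → ℝ}
    (hh : IsSteadyState r ε hbar 0 h) (hu : IsFirstOrderSolution r ε h u) :
    SolvabilityCondition r h := by
  have h1 := integral_K_mul_deriv hh hu.1
  have hc' : Continuous (deriv h) := (contDiff_one_deriv hh.contDiff).continuous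
  have hf := continuous_f₂_comp r hh.contDiff.continuous hh.pos
  have hG := continuous_G
  have e : ∀ x, K ε h u x * deriv h x = (∫ y in (0 : ℝ)..1, f₂ r (h y) * G y) * deriv h x
      - f₂ r (h x) * deriv h x * G x := fun x => by
    rw [hu.2 x]
    ring
  simp only [e] at h1
  rw [intervalIntegral.integral_sub ((by fun_prop : Continuous fun x => _).intervalIntegrable _ _)
    ((by fun_prop : Continuous fun x => _).intervalIntegrable _ _),
    intervalIntegral.integral_const_mul, integral_deriv_eq_zero hh.contDiff hh.periodic] at h1
  rw [SolvabilityCondition]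
  linarith

/-- Chain rule and integration by parts. The right side contains no derivative of `h`, which makes
the functional continuous, and even smooth, in the uniform norm at positive profiles. -/
theorem integral_f₂_mul_deriv_mul_G (r : Range) {h : ℝ → ℝ} (hC : ContDiff ℝ 2 h)
    (hp : Function.Periodic h 1) (hpos : ∀ x, 0 < h x) :
    ∫ x in (0 : ℝ)..1, f₂ r (h x) * deriv h x * G x
      = -(2 * Real.pi) * ∫ x in (0 : ℝ)..1, F₂ r (h x) * Real.cos (2 * Real.pi * x) := by
  have hc' : Continuous (deriv h) := (contDiff_one_deriv hC).continuous
  have hf := continuous_f₂_comp r hC.continuous hpos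
  have key := integral_mul_deriv_periodic (u := fun x => F₂ r (h x))
    (u' := fun x => f₂ r (h x) * deriv h x) (fun x => by simp only [hp x]) periodic_G
    (fun x => (hasDerivAt_F₂ r (hpos x).ne').comp x (hasDerivAt_of_contDiff_two hC x))
    hasDerivAt_G (by fun_prop) (by fun_prop)
  have e : ∀ x, F₂ r (h x) * (2 * Real.pi * Real.cos (2 * Real.pi * x))
      = 2 * Real.pi * (F₂ r (h x) * Real.cos (2 * Real.pi * x)) := fun x => by ring
  simp only [e, intervalIntegral.integral_const_mul] at key
  linarith

/-- The identity obtained by testing a forced steady state equation with the derivative of its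
solution. -/
theorem energy_identity {r : Range} {ε ρ b c : ℝ} {w k : ℝ → ℝ} (hC : ContDiff ℝ 2 w)
    (hp : Function.Periodic w 1) (hpos : ∀ x, 0 < w x) (hk : Continuous k)
    (heq : ∀ x, ε ^ 2 * deriv (deriv w) x + disjoiningPressure r ρ (w x) x - c = b * k x) :
    ρ * ∫ x in (0 : ℝ)..1, f₂ r (w x) * deriv w x * G x
      = b * ∫ x in (0 : ℝ)..1, k x * deriv w x := by
  have hc' : Continuous (deriv w) := (contDiff_one_deriv hC).continuous
  have hf := continuous_f₂_comp r hC.continuous hpos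
  have hG := continuous_G
  have hd1 := hasDerivAt_of_contDiff_two hC
  have hd2 := hasDerivAt_deriv_of_contDiff_two hC
  have key := integral_deriv_periodic
    (u := fun x => ε ^ 2 / 2 * (deriv w x * deriv w x) + (F₂ .SR (w x) + F₂ .LR (w x)) - c * w x)
    (u' := fun x => b * (k x * deriv w x) - ρ * (f₂ r (w x) * deriv w x * G x))
    (fun x => by simp only [hp x, periodic_deriv hp x])
    (fun x => by
      have := ((((hd2 x).mul (hd2 x)).const_mul (ε ^ 2 / 2)).add
        (((hasDerivAt_F₂ .SR (hpos x).ne').comp x (hd1 x)).add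
          ((hasDerivAt_F₂ .LR (hpos x).ne').comp x (hd1 x)))).sub ((hd1 x).const_mul c)
      convert! this using 1
      have e := heq x
      rw [disjoiningPressure_eq, f₁_eq_add] at e
      linear_combination -deriv w x * e)
    (by fun_prop)
  rw [intervalIntegral.integral_sub ((by fun_prop : Continuous fun x => _).intervalIntegrable _ _)
    ((by fun_prop : Continuous fun x => _).intervalIntegrable _ _),
    intervalIntegral.integral_const_mul, intervalIntegral.integral_const_mul] at key
  linarith

/-- The energy identity without forcing, divided by `ρ`: an exact constraint on every steady state
with nonzero contrast. -/
theorem IsSteadyState.integral_F₂_mul_cos {r : Range} {ε hbar ρ : ℝ} {h : ℝ → ℝ}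
    (hh : IsSteadyState r ε hbar ρ h) (hρ : ρ ≠ 0) :
    ∫ x in (0 : ℝ)..1, F₂ r (h x) * Real.cos (2 * Real.pi * x) = 0 := by
  have h1 := energy_identity (r := r) (ε := ε) (ρ := ρ) (b := 0) (k := fun _ => 0)
    hh.contDiff hh.periodic hh.pos continuous_const fun x => (hh.equation x).trans (by simp)
  rw [integral_f₂_mul_deriv_mul_G r hh.contDiff hh.periodic hh.pos, zero_mul] at h1
  have := Real.pi_ne_zero
  simpa [hρ, this] using h1

theorem solvabilityCondition_iff (r : Range) {h : ℝ → ℝ} (hC : ContDiff ℝ 2 h)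
    (hp : Function.Periodic h 1) (hpos : ∀ x, 0 < h x) :
    SolvabilityCondition r h ↔
      ∫ x in (0 : ℝ)..1, F₂ r (h x) * Real.cos (2 * Real.pi * x) = 0 := by
  rw [SolvabilityCondition, integral_f₂_mul_deriv_mul_G r hC hp hpos]
  simp [Real.pi_ne_zero]

/-! ### Superposition operators and the obstruction functional -/

namespace PeriodicMap

theorem eventually_pos {w : PeriodicMap} (hw : ∀ x, 0 < w x) : ∀ᶠ v in 𝓝 w, ∀ x, 0 < v x := by
  obtain ⟨x₀, -, hx₀⟩ := isCompact_univ.exists_isMinOn Set.univ_nonempty w.continuous.continuousOn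
  filter_upwards [Metric.ball_mem_nhds w (hw x₀)] with v hv x
  have h1 : dist (v x) (w x) < w x₀ := (ContinuousMap.dist_apply_le_dist x).trans_lt hv
  have h2 : w x₀ ≤ w x := hx₀ (Set.mem_univ x)
  rw [Real.dist_eq, abs_lt] at h1
  linarith [h1.1]

theorem pos_of_line_pos {w : PeriodicMap} (hw : ∀ x : ℝ, 0 < w x) : ∀ x, 0 < w x := fun x => by
  induction x using QuotientAddGroup.induction_on with
  | H x => exact hw x

theorem isUnit_of_pos {w : PeriodicMap} (hw : ∀ x, 0 < w x) : IsUnit w :=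
  (ContinuousMap.isUnit_iff_forall_ne_zero w).mpr fun x => (hw x).ne'

theorem inverse_apply {w : PeriodicMap} (hw : ∀ x, 0 < w x) (x : UnitAddCircle) :
    Ring.inverse w x = (w x)⁻¹ := by
  have h := congrArg (fun g : PeriodicMap => g x) (Ring.mul_inverse_cancel w (isUnit_of_pos hw))
  exact eq_inv_of_mul_eq_one_right h

/-- Composition with `f₁`. -/
def compf₁ (w : PeriodicMap) : PeriodicMap := Ring.inverse w ^ 6 - Ring.inverse w ^ 3

/-- Composition with `f₂ r`. -/
def compf₂ : Range → PeriodicMap → PeriodicMap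
  | .LR, w => -Ring.inverse w ^ 3
  | .SR, w => Ring.inverse w ^ 6

/-- Composition with `F₂ r`. -/
def compF₂ : Range → PeriodicMap → PeriodicMap
  | .LR, w => (2⁻¹ : ℝ) • Ring.inverse w ^ 2
  | .SR, w => (-5⁻¹ : ℝ) • Ring.inverse w ^ 5

theorem compf₁_apply {w : PeriodicMap} (hw : ∀ x, 0 < w x) (x : UnitAddCircle) :
    compf₁ w x = f₁ (w x) := by
  simp [compf₁, f₁, inverse_apply hw]

theorem compf₂_apply (r : Range) {w : PeriodicMap} (hw : ∀ x, 0 < w x) (x : UnitAddCircle) :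
    compf₂ r w x = f₂ r (w x) := by
  cases r <;> simp [compf₂, f₂, inverse_apply hw]

theorem compF₂_apply (r : Range) {w : PeriodicMap} (hw : ∀ x, 0 < w x) (x : UnitAddCircle) :
    compF₂ r w x = F₂ r (w x) := by
  cases r <;> simp [compF₂, F₂, inverse_apply hw]

/-- Inversion is smooth at the units of a Banach algebra. The superposition operators above are
polynomials in the inverse, so their smoothness follows. -/
theorem contDiffAt_inverse {n : WithTop ℕ∞} {w : PeriodicMap} (hw : ∀ x, 0 < w x) :
    ContDiffAt ℝ n (Ring.inverse : PeriodicMap → PeriodicMap) w := by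
  obtain ⟨v, rfl⟩ := isUnit_of_pos hw
  exact contDiffAt_ringInverse ℝ v

theorem contDiffAt_compf₁ {n : WithTop ℕ∞} {w : PeriodicMap} (hw : ∀ x, 0 < w x) :
    ContDiffAt ℝ n compf₁ w :=
  ((contDiffAt_inverse hw).pow 6).sub ((contDiffAt_inverse hw).pow 3)

theorem contDiffAt_compf₂ {n : WithTop ℕ∞} (r : Range) {w : PeriodicMap} (hw : ∀ x, 0 < w x) :
    ContDiffAt ℝ n (compf₂ r) w := by
  cases r
  · exact ((contDiffAt_inverse hw).pow 3).neg
  · exact (contDiffAt_inverse hw).pow 6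

theorem contDiffAt_compF₂ {n : WithTop ℕ∞} (r : Range) {w : PeriodicMap} (hw : ∀ x, 0 < w x) :
    ContDiffAt ℝ n (compF₂ r) w := by
  cases r
  · exact ((contDiffAt_inverse hw).pow 2).const_smul _
  · exact ((contDiffAt_inverse hw).pow 5).const_smul _

/-- The derivative of a superposition operator is multiplication by the derivative. -/
theorem fderiv_superposition_apply {N : PeriodicMap → PeriodicMap} {f : ℝ → ℝ} {w : PeriodicMap}
    (hN : DifferentiableAt ℝ N w) (hf : ∀ᶠ v in 𝓝 w, ∀ x, N v x = f (v x)) {d : ℝ}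
    {x : UnitAddCircle} (hd : HasDerivAt f d (w x)) (u : PeriodicMap) :
    fderiv ℝ N w u x = d * u x := by
  -- Differentiate along a line and evaluate at `x`; this reduces the claim to the scalar chain
  -- rule.
  have hpath : HasDerivAt (fun t : ℝ => w + t • u) u 0 := by
    simpa using ((hasDerivAt_id (0 : ℝ)).smul_const u).const_add w
  have hN' : HasFDerivAt N (fderiv ℝ N w) (w + (0 : ℝ) • u) := by simpa using hN.hasFDerivAt
  have h1 := (ContinuousMap.evalCLM ℝ x).hasFDerivAt.comp_hasDerivAt (0 : ℝ)
    (hN'.comp_hasDerivAt (0 : ℝ) hpath)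
  have hline : HasDerivAt (fun t : ℝ => w x + t * u x) (u x) 0 := by
    simpa using ((hasDerivAt_id (0 : ℝ)).mul_const (u x)).const_add (w x)
  have hd' : HasDerivAt f d (w x + 0 * u x) := by simpa using hd
  have h2 := hd'.comp (0 : ℝ) hline
  have hev : ∀ᶠ t in 𝓝 (0 : ℝ), ∀ y, N (w + t • u) y = f ((w + t • u) y) := by
    have : Filter.Tendsto (fun t : ℝ => w + t • u) (𝓝 0) (𝓝 w) := by
      simpa using hpath.continuousAt.tendsto
    exact this.eventually hf
  refine h1.unique (h2.congr_of_eventuallyEq ?_)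
  filter_upwards [hev] with t ht
  simpa using ht x

theorem fderiv_compf₁_apply {w : PeriodicMap} (hw : ∀ x, 0 < w x) (u : PeriodicMap)
    (x : UnitAddCircle) : fderiv ℝ compf₁ w u x = deriv f₁ (w x) * u x :=
  fderiv_superposition_apply ((contDiffAt_compf₁ (n := 1) hw).differentiableAt one_ne_zero)
    ((eventually_pos hw).mono fun _ hv => compf₁_apply hv) (hasDerivAt_f₁ (hw x).ne') u

theorem fderiv_compF₂_apply (r : Range) {w : PeriodicMap} (hw : ∀ x, 0 < w x) (u : PeriodicMap)
    (x : UnitAddCircle) : fderiv ℝ (compF₂ r) w u x = f₂ r (w x) * u x :=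
  fderiv_superposition_apply ((contDiffAt_compF₂ (n := 1) r hw).differentiableAt one_ne_zero)
    ((eventually_pos hw).mono fun _ hv => compF₂_apply r hv) (hasDerivAt_F₂ r (hw x).ne') u

/-- The pattern `G` on the circle. -/
def pattern : PeriodicMap := ofPeriodic G continuous_G periodic_G

/-- The function `cos (2πx)` on the circle. -/
def cosine : PeriodicMap := ofPeriodic _ continuous_cos_two_pi periodic_cos_two_pi

/-- The disjoining pressure of a film profile. -/
def pressure (r : Range) (ρ : ℝ) (w : PeriodicMap) : PeriodicMap :=
  compf₁ w + ρ • (compf₂ r w * pattern)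

theorem pressure_coe (r : Range) (ρ : ℝ) {w : PeriodicMap} (hw : ∀ x, 0 < w x) (x : ℝ) :
    pressure r ρ w x = disjoiningPressure r ρ (w x) x := by
  simp [pressure, compf₁_apply hw, compf₂_apply r hw, disjoiningPressure_eq, pattern, mul_assoc]

theorem mean_pressure (r : Range) (ρ : ℝ) {w : PeriodicMap} (hw : ∀ x, 0 < w x) :
    mean (pressure r ρ w) = ∫ x in (0 : ℝ)..1, disjoiningPressure r ρ (w x) x := by
  simp only [mean_apply, pressure_coe r ρ hw]

/-- The obstruction functional, whose vanishing at a steady state is the solvability condition. -/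
def obstruction (r : Range) (w : PeriodicMap) : ℝ := mean (compF₂ r w * cosine)

theorem obstruction_eq (r : Range) {w : PeriodicMap} (hw : ∀ x, 0 < w x) :
    obstruction r w = ∫ x in (0 : ℝ)..1, F₂ r (w x) * Real.cos (2 * Real.pi * x) := by
  simp only [obstruction, mean_apply, ContinuousMap.mul_apply, compF₂_apply r hw, cosine,
    ofPeriodic_coe]

theorem contDiffAt_obstruction {n : WithTop ℕ∞} (r : Range) {w : PeriodicMap}
    (hw : ∀ x, 0 < w x) : ContDiffAt ℝ n (obstruction r) w :=
  mean.contDiff.contDiffAt.comp w ((contDiffAt_compF₂ r hw).mul contDiffAt_const)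

end PeriodicMap

open PeriodicMap

/-! ### Necessity of the solvability condition for persistence -/

/-- Uniform limits of steady states with nonvanishing contrast satisfy the solvability
condition. -/
theorem solvabilityCondition_of_tendstoUniformly {r : Range} {ε hbar : ℝ} {h₀ : ℝ → ℝ}
    (hC : ContDiff ℝ 2 h₀) (hp : Function.Periodic h₀ 1) (hpos : ∀ x, 0 < h₀ x)
    {ρ : ℕ → ℝ} {h : ℕ → ℝ → ℝ} (hρ : ∀ n, ρ n ≠ 0)
    (hh : ∀ n, IsSteadyState r ε hbar (ρ n) (h n))
    (hlim : TendstoUniformly h h₀ Filter.atTop) : SolvabilityCondition r h₀ := by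
  let w : PeriodicMap := ofPeriodic h₀ hC.continuous hp
  let v : ℕ → PeriodicMap := fun n =>
    ofPeriodic (h n) (hh n).contDiff.continuous (hh n).periodic
  have hw : ∀ x, 0 < w x := pos_of_line_pos hpos
  have hv : ∀ n x, 0 < v n x := fun n => pos_of_line_pos (hh n).pos
  have hvw : Filter.Tendsto v Filter.atTop (𝓝 w) := by
    rw [Metric.tendsto_atTop]
    intro η hη
    obtain ⟨N, hN⟩ := Filter.eventually_atTop.mp
      (Metric.tendstoUniformly_iff.mp hlim (η / 2) (by positivity))
    refine ⟨N, fun n hn => ?_⟩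
    rw [dist_eq_norm]
    refine lt_of_le_of_lt ((norm_le_iff (by positivity)).mpr fun x => ?_) (half_lt_self hη)
    have := (hN n hn x).le
    rw [dist_comm, Real.dist_eq] at this
    exact this
  have h1 := ((contDiffAt_obstruction (n := 0) r hw).continuousAt.tendsto.comp hvw)
  have h2 : obstruction r w = 0 := by
    refine tendsto_nhds_unique h1 (tendsto_const_nhds.congr fun n => ?_)
    rw [Function.comp_apply, obstruction_eq r (hv n)]
    exact ((hh n).integral_F₂_mul_cos (hρ n)).symm
  rw [solvabilityCondition_iff r hC hp hpos]
  rw [obstruction_eq r hw] at h2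
  exact h2

/-! ### Functional-analytic tools: Fredholm alternative and Taylor bound -/

/-- The Fredholm alternative for compact perturbations of the identity. -/
theorem isInvertible_one_add_of_isCompactOperator {E : Type*} [NormedAddCommGroup E]
    [NormedSpace ℝ E] [CompleteSpace E] {T : E →L[ℝ] E} (hT : IsCompactOperator T)
    (hinj : ∀ u, u + T u = 0 → u = 0) : (1 + T).IsInvertible := by
  have hT' : IsCompactOperator (-T : E →L[ℝ] E) := hT.neg
  rcases hT'.hasEigenvalue_or_mem_resolventSet (one_ne_zero (α := ℝ)) with h | h
  · obtain ⟨u, hu⟩ := h.exists_hasEigenvector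
    refine absurd (hinj u ?_) hu.2
    have h1 : -T u = u := by simpa using hu.apply_eq_smul
    nth_rewrite 1 [← h1]
    simp
  · rw [spectrum.mem_resolventSet_iff] at h
    obtain ⟨v, hv⟩ := h
    refine ⟨ContinuousLinearEquiv.ofUnit v, ?_⟩
    change (v : E →L[ℝ] E) = 1 + T
    rw [hv]
    simp

/-- Second-order Taylor estimate for curves. -/
theorem exists_taylor_bound {E : Type*} [NormedAddCommGroup E] [NormedSpace ℝ E]
    {ψ : ℝ → E} (hψ : ContDiffAt ℝ 2 ψ 0) :
    ∃ C : ℝ, ∃ ρ₀ > 0, ∀ ρ : ℝ, |ρ| < ρ₀ → ‖ψ ρ - ψ 0 - ρ • deriv ψ 0‖ ≤ C * ρ ^ 2 := by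
  have hd : ContDiffAt ℝ 1 (deriv ψ) 0 := by
    have := (hψ.fderiv_right (m := 1) (by norm_num)).clm_apply
      (contDiffAt_const (c := (1 : ℝ)))
    exact this
  obtain ⟨C, t, ht, hlip⟩ := hd.exists_lipschitzOnWith
  have hdiff : ∀ᶠ y in 𝓝 (0 : ℝ), DifferentiableAt ℝ ψ y :=
    (hψ.eventually (by simp)).mono fun y hy => hy.differentiableAt two_ne_zero
  obtain ⟨ρ₀, hρ₀, hball⟩ := Metric.mem_nhds_iff.mp (Filter.inter_mem ht hdiff)
  refine ⟨C, ρ₀, hρ₀, fun ρ hρ => ?_⟩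
  have hsub : ∀ y ∈ Metric.closedBall (0 : ℝ) |ρ|, y ∈ Metric.ball (0 : ℝ) ρ₀ := fun y hy =>
    Metric.closedBall_subset_ball hρ hy
  -- Mean value inequality for `ψ y - y • ψ'(0)`: as `ψ'` is Lipschitz near `0`, the derivative is
  -- at most `C * |ρ|` on this ball.
  have key := (convex_closedBall (0 : ℝ) |ρ|).norm_image_sub_le_of_norm_hasDerivWithin_le
    (f := fun y => ψ y - y • deriv ψ 0) (f' := fun y => deriv ψ y - deriv ψ 0)
    (C := C * |ρ|) (x := 0) (y := ρ)
    (fun y hy => by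
      have h1 : HasDerivAt ψ (deriv ψ y) y := (hball (hsub y hy)).2.hasDerivAt
      have h2 := (hasDerivAt_id y).smul_const (deriv ψ 0)
      rw [one_smul] at h2
      exact (h1.sub h2).hasDerivWithinAt)
    (fun y hy => by
      have h1 := hlip.dist_le_mul y (hball (hsub y hy)).1 0 (mem_of_mem_nhds ht)
      rw [dist_eq_norm] at h1
      exact h1.trans (mul_le_mul_of_nonneg_left hy C.2))
    (by simp) (by simp)
  calc ‖ψ ρ - ψ 0 - ρ • deriv ψ 0‖ = ‖ψ ρ - ρ • deriv ψ 0 - (ψ 0 - (0 : ℝ) • deriv ψ 0)‖ := by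
        congr 1
        simp only [zero_smul, sub_zero]
        abel
    _ ≤ C * |ρ| * ‖ρ - 0‖ := key
    _ = C * ρ ^ 2 := by rw [sub_zero, Real.norm_eq_abs, mul_assoc, abs_mul_abs_self, sq]

/-! ### The stabilised integral equation and its linearisation -/

namespace PeriodicMap

/-- Inverting `u''` absorbs the side conditions: `green` discards the mean of the pressure, hence
the nonlocal term, and the free constant is the prescribed mean thickness. -/
theorem isSteadyState_residual {r : Range} {ε hbar ρ : ℝ} (hε : 0 < ε) {h : ℝ → ℝ}
    (hh : IsSteadyState r ε hbar ρ h) :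
    let w := ofPeriodic h hh.contDiff.continuous hh.periodic
    w = hbar • (1 : PeriodicMap) - (ε ^ 2)⁻¹ • green (pressure r ρ w) := by
  intro w
  have hw : ∀ x, 0 < w x := pos_of_line_pos hh.pos
  refine ext_coe fun x => ?_
  have h1 := eq_mean_add_green hh.contDiff hh.periodic
    (g := -(ε ^ 2)⁻¹ • pressure r ρ w) (fun x => by
      have e := hh.equation x
      rw [ContinuousMap.smul_apply, map_smul, pressure_coe r ρ hw, mean_pressure r ρ hw,
        smul_eq_mul, smul_eq_mul]
      change _ = -(ε ^ 2)⁻¹ * disjoiningPressure r ρ (h x) x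
        - -(ε ^ 2)⁻¹ * ∫ y in (0 : ℝ)..1, disjoiningPressure r ρ (h y) y
      field_simp
      linarith) x
  rw [hh.mean, map_smul] at h1
  simpa [w, sub_eq_add_neg] using h1

/-- Fixed points of the integral equation with a forcing term solve the forced steady state
equation. -/
theorem forced_equation {r : Range} {ε hbar ρ b : ℝ} (hε : 0 < ε) {w k : PeriodicMap}
    (hw : ∀ x, 0 < w x) (hk : mean k = 0)
    (h : w = hbar • (1 : PeriodicMap) - (ε ^ 2)⁻¹ • green (pressure r ρ w) + b • green k) :
    ContDiff ℝ 2 (fun x : ℝ => w x) ∧ (∫ x in (0 : ℝ)..1, w x = hbar) ∧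
      ∀ x : ℝ, ε ^ 2 * deriv (deriv fun x : ℝ => w x) x + disjoiningPressure r ρ (w x) x
        - ∫ y in (0 : ℝ)..1, disjoiningPressure r ρ (w y) y = ε ^ 2 * b * k x := by
  set g : PeriodicMap := -(ε ^ 2)⁻¹ • pressure r ρ w + b • k with hg
  have hwg : w = hbar • (1 : PeriodicMap) + green g := by
    rw [hg, map_add, map_smul, map_smul, neg_smul, ← add_assoc, ← sub_eq_add_neg]
    exact h
  have hfun : (fun x : ℝ => w x) = fun x : ℝ => hbar + green g x := funext fun x => by
    conv_lhs => rw [hwg]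
    simp
  refine ⟨?_, ?_, fun x => ?_⟩
  · rw [hfun]
    exact contDiff_const.add (contDiff_green g)
  · rw [← mean_apply]
    conv_lhs => rw [hwg]
    simp [mean_one, mean_green]
  · have e : deriv (fun x : ℝ => w x) = deriv fun x : ℝ => green g x := by
      rw [hfun]
      exact funext fun y => deriv_const_add hbar
    rw [e, deriv_deriv_green, hg, map_add, map_smul, map_smul, hk, ContinuousMap.add_apply,
      ContinuousMap.smul_apply, ContinuousMap.smul_apply, pressure_coe r ρ hw,
      mean_pressure r ρ hw]
    simp only [smul_eq_mul]
    field_simp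
    ring

theorem isSteadyState_of_eq {r : Range} {ε hbar ρ : ℝ} (hε : 0 < ε) {w : PeriodicMap}
    (hw : ∀ x, 0 < w x)
    (h : w = hbar • (1 : PeriodicMap) - (ε ^ 2)⁻¹ • green (pressure r ρ w)) :
    IsSteadyState r ε hbar ρ fun x : ℝ => w x := by
  obtain ⟨h1, h2, h3⟩ := forced_equation (b := 0) (k := 0) hε hw (map_zero _)
    (by simpa using h)
  exact ⟨h1, periodic_line w, fun x => hw x, fun x => by simpa using h3 x, h2⟩

/-- The integral equation for steady states, stabilised by the obstruction functional in the
direction `e`. -/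
def stabilised (r : Range) (ε hbar : ℝ) (e : PeriodicMap) (p : ℝ × PeriodicMap) : PeriodicMap :=
  p.2 - hbar • (1 : PeriodicMap) + (ε ^ 2)⁻¹ • green (pressure r p.1 p.2)
    - obstruction r p.2 • e

theorem contDiffAt_pressure {n : WithTop ℕ∞} (r : Range) {p : ℝ × PeriodicMap}
    (hw : ∀ x, 0 < p.2 x) :
    ContDiffAt ℝ n (fun p : ℝ × PeriodicMap => pressure r p.1 p.2) p :=
  ((contDiffAt_compf₁ hw).comp p contDiffAt_snd).add
    (contDiffAt_fst.smul (((contDiffAt_compf₂ r hw).comp p contDiffAt_snd).mul contDiffAt_const))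

theorem contDiffAt_stabilised {n : WithTop ℕ∞} (r : Range) (ε hbar : ℝ) (e : PeriodicMap)
    {p : ℝ × PeriodicMap} (hw : ∀ x, 0 < p.2 x) :
    ContDiffAt ℝ n (stabilised r ε hbar e) p :=
  ((contDiffAt_snd.sub contDiffAt_const).add
    ((green.contDiff.contDiffAt.comp p (contDiffAt_pressure r hw)).const_smul _)).sub
    (((contDiffAt_obstruction r hw).comp p contDiffAt_snd).smul contDiffAt_const)

/-- At `u = w'`, for differentiable `w`, this is the rate of change of the obstruction under
translation; it is nonzero exactly at a simple zero along the orbit. -/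
theorem fderiv_obstruction_apply (r : Range) {w : PeriodicMap} (hw : ∀ x, 0 < w x)
    (u : PeriodicMap) :
    fderiv ℝ (obstruction r) w u
      = ∫ x in (0 : ℝ)..1, f₂ r (w x) * u x * Real.cos (2 * Real.pi * x) := by
  have h1 : HasFDerivAt (compF₂ r) (fderiv ℝ (compF₂ r) w) w :=
    ((contDiffAt_compF₂ (n := 1) r hw).differentiableAt one_ne_zero).hasFDerivAt
  have h2 : HasFDerivAt (obstruction r) _ w :=
    mean.hasFDerivAt.comp w (h1.mul_const cosine)
  rw [h2.fderiv]
  simp only [ContinuousLinearMap.comp_apply, smul_apply, mean_apply,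
    smul_eq_mul, ContinuousMap.mul_apply, fderiv_compF₂_apply r hw]
  refine intervalIntegral.integral_congr fun x _ => ?_
  simp only [cosine, ofPeriodic_coe]
  ring

/-- The compact part of the linearisation of `stabilised`. -/
def compactPart (r : Range) (ε : ℝ) (e w : PeriodicMap) : PeriodicMap →L[ℝ] PeriodicMap :=
  (ε ^ 2)⁻¹ • green.comp (fderiv ℝ compf₁ w) - (fderiv ℝ (obstruction r) w).smulRight e

theorem isCompactOperator_compactPart (r : Range) (ε : ℝ) (e w : PeriodicMap) :
    IsCompactOperator (compactPart r ε e w) := by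
  have h1 : IsCompactOperator ((fderiv ℝ (obstruction r) w).smulRight e) :=
    (isCompactOperator_of_locallyCompactSpace_rng (ContinuousLinearMap.toSpanSingleton ℝ e)
      ).comp_clm (fderiv ℝ (obstruction r) w)
  exact ((isCompactOperator_green.comp_clm _).smul _).sub h1

theorem fderiv_stabilised_comp_inr (r : Range) (ε hbar : ℝ) (e : PeriodicMap) {w : PeriodicMap}
    (hw : ∀ x, 0 < w x) :
    fderiv ℝ (stabilised r ε hbar e) (0, w) ∘L .inr ℝ ℝ PeriodicMap
      = 1 + compactPart r ε e w := by
  have h1 : HasFDerivAt (stabilised r ε hbar e) _ ((0 : ℝ), w) :=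
    ((contDiffAt_stabilised (n := 1) r ε hbar e (p := (0, w)) hw).differentiableAt
      one_ne_zero).hasFDerivAt
  have h2 := h1.comp w (hasFDerivAt_prodMk_right (0 : ℝ) w)
  have h3 : HasFDerivAt compf₁ (fderiv ℝ compf₁ w) w :=
    ((contDiffAt_compf₁ (n := 1) hw).differentiableAt one_ne_zero).hasFDerivAt
  have h4 : HasFDerivAt (obstruction r) (fderiv ℝ (obstruction r) w) w :=
    ((contDiffAt_obstruction (n := 1) r hw).differentiableAt one_ne_zero).hasFDerivAt
  have h5 := (((hasFDerivAt_id w).sub_const (hbar • (1 : PeriodicMap))).add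
    ((green.hasFDerivAt.comp w h3).const_smul (ε ^ 2)⁻¹)).sub (h4.smul_const e)
  have h6 : (stabilised r ε hbar e ∘ fun v => ((0 : ℝ), v)) = fun v =>
      v - hbar • (1 : PeriodicMap) + (ε ^ 2)⁻¹ • green (compf₁ v) - obstruction r v • e :=
    funext fun v => by simp [stabilised, pressure]
  rw [h6] at h2
  refine h2.unique (h5.congr_fderiv ?_)
  rw [compactPart, ← add_sub_assoc]
  rfl

end PeriodicMap

/-- Translation conjugates the linearisations at `h` and at its translate. -/
theorem Nondegenerate.shift {ε : ℝ} {h : ℝ → ℝ} (hn : Nondegenerate ε h)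
    (hp : Function.Periodic h 1) (s : ℝ) : Nondegenerate ε (shift h s) := by
  intro u hu hK
  have hmean : ∫ y in (0 : ℝ)..1, deriv f₁ (h y) * ThinFilm.shift u (-s) y
      = ∫ y in (0 : ℝ)..1, deriv f₁ (ThinFilm.shift h s y) * u y := by
    rw [← integral_shift (k := fun y => deriv f₁ (h y) * ThinFilm.shift u (-s) y) (fun y => by
      simp only [ThinFilm.shift]
      rw [hp, add_right_comm, hu.periodic]) s]
    exact intervalIntegral.integral_congr fun y _ => by simp [ThinFilm.shift]
  obtain ⟨c, hc⟩ := hn (ThinFilm.shift u (-s))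
    ⟨hu.contDiff.comp (contDiff_id.add contDiff_const), fun x => by
      simp only [ThinFilm.shift]
      rw [add_right_comm, hu.periodic], (integral_shift hu.periodic _).trans hu.mean⟩
    (fun x => by
      have := hK (x + -s)
      simp only [K] at this ⊢
      rw [deriv_deriv_shift, hmean]
      simpa [ThinFilm.shift] using this)
  refine ⟨c, fun x => ?_⟩
  have := hc (x + s)
  rw [deriv_shift]
  simpa [ThinFilm.shift] using this

/-! ### The unique branch through a simple zero -/

/-- Near a nondegenerate steady state at which the solvability functional has a simple zero, the
perturbed problem has exactly one solution, and it has a first-order expansion. -/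
theorem exists_unique_branch {r : Range} {ε hbar : ℝ} (hε : 0 < ε) {h : ℝ → ℝ}
    (hh : IsSteadyState r ε hbar 0 h) (hn : Nondegenerate ε h) (hs : SolvabilityCondition r h)
    (hsimple : ∫ x in (0 : ℝ)..1, f₂ r (h x) * deriv h x * Real.cos (2 * Real.pi * x) ≠ 0) :
    ∃ u, IsFirstOrderSolution r ε h u ∧ ∃ η > 0, ∃ ρ₀ > 0, ∃ C : ℝ, ∃ H : ℝ → ℝ → ℝ,
      ∀ ρ : ℝ, 0 < |ρ| → |ρ| < ρ₀ →
        (∀ k, IsSteadyState r ε hbar ρ k → (∀ x, |k x - h x| ≤ η) → k = H ρ) ∧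
        IsSteadyState r ε hbar ρ (H ρ) ∧ ∀ x, |H ρ x - h x - ρ * u x| ≤ C * ρ ^ 2 := by
  have hc' : Continuous (deriv h) := (contDiff_one_deriv hh.contDiff).continuous
  let w : PeriodicMap := ofPeriodic h hh.contDiff.continuous hh.periodic
  let w' : PeriodicMap := ofPeriodic (deriv h) hc' (periodic_deriv hh.periodic)
  let w'' : PeriodicMap := ofPeriodic (deriv (deriv h)) (continuous_deriv_deriv hh.contDiff)
    (periodic_deriv (periodic_deriv hh.periodic))
  let e : PeriodicMap := green w'
  have hw : ∀ x, 0 < w x := pos_of_line_pos hh.pos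
  have hw'mean : mean w' = 0 := integral_deriv_eq_zero hh.contDiff hh.periodic
  have hobs : obstruction r w = 0 := by
    rw [obstruction_eq r hw]
    exact (solvabilityCondition_iff r hh.contDiff hh.periodic hh.pos).mp hs
  -- If `h'` vanished throughout the period, the integral in `hsimple` would be zero.
  have hsq : 0 < ∫ x in (0 : ℝ)..1, deriv h x * deriv h x := by
    refine intervalIntegral.integral_pos one_pos (hc'.mul hc').continuousOn
      (fun x _ => mul_self_nonneg _) ?_
    by_contra! hcon
    refine hsimple ((intervalIntegral.integral_congr fun x hx => ?_).trans
      intervalIntegral.integral_zero)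
    rw [Set.uIcc_of_le zero_le_one] at hx
    have : deriv h x = 0 := mul_self_eq_zero.mp (le_antisymm (hcon x hx) (mul_self_nonneg _))
    simp [this]
  -- invertibility of the linearisation
  have hinj : ∀ u, u + compactPart r ε e w u = 0 → u = 0 := by
    intro u hu
    set b := fderiv ℝ (obstruction r) w u with hb
    have hug : u = green (-(ε ^ 2)⁻¹ • fderiv ℝ compf₁ w u + b • w') := by
      rw [map_add, map_smul, map_smul, neg_smul]
      have : compactPart r ε e w u = (ε ^ 2)⁻¹ • green (fderiv ℝ compf₁ w u) - b • e := rfl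
      rw [this, ← eq_neg_iff_add_eq_zero] at hu
      conv_lhs => rw [hu]
      abel
    set g := -(ε ^ 2)⁻¹ • fderiv ℝ compf₁ w u + b • w' with hg
    have hdom : InDomain fun x : ℝ => u x := by
      refine ⟨?_, periodic_line u, ?_⟩
      · rw [hug]
        exact contDiff_green g
      · rw [← mean_apply, hug, mean_green]
    have hKu : ∀ x : ℝ, K ε h (fun x : ℝ => u x) x = ε ^ 2 * b * deriv h x := by
      intro x
      have h1 : deriv (deriv fun x : ℝ => u x) x = g x - mean g := by
        conv_lhs => rw [hug]
        exact deriv_deriv_green g x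
      have h2 : mean (fderiv ℝ compf₁ w u) = ∫ y in (0 : ℝ)..1, deriv f₁ (h y) * u y := by
        simp only [mean_apply, fderiv_compf₁_apply hw]
        rfl
      rw [K, h1, ← h2, hg, map_add, map_smul, map_smul, hw'mean, ContinuousMap.add_apply,
        ContinuousMap.smul_apply, ContinuousMap.smul_apply, fderiv_compf₁_apply hw]
      simp only [smul_eq_mul]
      change ε ^ 2 * (-(ε ^ 2)⁻¹ * (deriv f₁ (h x) * u x) + b * deriv h x - _) + _ - _ = _
      field_simp
      ring
    -- Testing with `h'` annihilates the left side and leaves `ε² b ∫ h'² = 0`.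
    have hb0 : b = 0 := by
      have h1 := integral_K_mul_deriv hh hdom
      simp only [hKu, mul_assoc, intervalIntegral.integral_const_mul] at h1
      simpa [hε.ne', hsq.ne'] using h1
    obtain ⟨c, hc⟩ := hn _ hdom fun x => by rw [hKu, hb0]; ring
    -- With `u = c h'`, the vanishing of `b` says that `c` times the nonzero integral in `hsimple`
    -- is zero.
    have hc0 : c = 0 := by
      have h1 := hb0
      rw [hb, fderiv_obstruction_apply r hw] at h1
      have h2 : ∀ x : ℝ, f₂ r (w x) * u x * Real.cos (2 * Real.pi * x)
          = c * (f₂ r (h x) * deriv h x * Real.cos (2 * Real.pi * x)) := fun x => by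
        rw [hc x]
        change f₂ r (h x) * _ * _ = _
        ring
      simp only [h2, intervalIntegral.integral_const_mul] at h1
      exact (mul_eq_zero.mp h1).resolve_right hsimple
    exact ext_coe fun x => by rw [hc x, hc0, zero_mul, ContinuousMap.zero_apply]
  have hinv : (fderiv ℝ (stabilised r ε hbar e) (0, w) ∘L .inr ℝ ℝ PeriodicMap).IsInvertible := by
    rw [fderiv_stabilised_comp_inr r ε hbar e hw]
    exact isInvertible_one_add_of_isCompactOperator (isCompactOperator_compactPart r ε e w) hinj
  have hcd : ContDiffAt ℝ 2 (stabilised r ε hbar e) (0, w) :=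
    contDiffAt_stabilised r ε hbar e hw
  have hzero : stabilised r ε hbar e (0, w) = 0 := by
    have := isSteadyState_residual hε hh
    simp only [stabilised, hobs, zero_smul, sub_zero]
    rw [sub_add, sub_eq_zero]
    exact this
  -- the implicit function
  set ψ := hcd.implicitFunction two_ne_zero hinv with hψ
  have hψ0 : ψ 0 = w := hcd.implicitFunction_apply_self two_ne_zero hinv
  have hψcd : ContDiffAt ℝ 2 ψ 0 := hcd.contDiffAt_implicitFunction two_ne_zero hinv
  have hψzero : ∀ᶠ ρ in 𝓝 (0 : ℝ), stabilised r ε hbar e (ρ, ψ ρ) = 0 := by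
    have := hcd.eventually_apply_implicitFunction two_ne_zero hinv
    rwa [hzero] at this
  have hψuniq : ∀ᶠ v in 𝓝 ((0 : ℝ), w), stabilised r ε hbar e v = 0 → ψ v.1 = v.2 := by
    have := hcd.eventually_apply_eq_iff_implicitFunction two_ne_zero hinv
    rw [hzero] at this
    exact this.mono fun v hv => hv.mp
  have hψtend : Filter.Tendsto ψ (𝓝 0) (𝓝 w) := by
    have := hψcd.continuousAt.tendsto
    rwa [hψ0] at this
  have hψpos : ∀ᶠ ρ in 𝓝 (0 : ℝ), ∀ x, 0 < ψ ρ x := hψtend.eventually (eventually_pos hw)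
  -- This is the factor multiplying the obstruction in the energy identity along the branch. At `ρ =
  -- 0` it equals `ε² ∫ h'² > 0`.
  have hψcoef : ∀ᶠ ρ in 𝓝 (0 : ℝ), 0 < ε ^ 2 * -mean (w'' * ψ ρ) + 2 * Real.pi * ρ := by
    have h1 : Filter.Tendsto (fun ρ : ℝ => ε ^ 2 * -mean (w'' * ψ ρ) + 2 * Real.pi * ρ) (𝓝 0)
        (𝓝 (ε ^ 2 * -mean (w'' * w) + 2 * Real.pi * 0)) :=
      (((mean.continuous.tendsto _).comp (tendsto_const_nhds.mul hψtend)).neg.const_mul _).add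
        (Filter.tendsto_id.const_mul _)
    refine h1.eventually (lt_mem_nhds ?_)
    have h2 : mean (w'' * w) = -∫ x in (0 : ℝ)..1, deriv h x * deriv h x := by
      have key := integral_mul_deriv_periodic (periodic_deriv hh.periodic) hh.periodic
        (hasDerivAt_deriv_of_contDiff_two hh.contDiff) (hasDerivAt_of_contDiff_two hh.contDiff)
        (continuous_deriv_deriv hh.contDiff) hc'
      exact neg_eq_iff_eq_neg.mp key.symm
    rw [h2, neg_neg, mul_zero, add_zero]
    positivity
  have hψfix : ∀ᶠ ρ in 𝓝 (0 : ℝ),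
      ψ ρ = hbar • (1 : PeriodicMap) - (ε ^ 2)⁻¹ • green (pressure r ρ (ψ ρ)) := by
    filter_upwards [hψzero, hψpos, hψcoef] with ρ h0 hpos hcoef
    set b := obstruction r (ψ ρ) with hb
    have hfix : ψ ρ = hbar • (1 : PeriodicMap) - (ε ^ 2)⁻¹ • green (pressure r ρ (ψ ρ))
        + b • e := by
      simp only [stabilised] at h0
      rw [← sub_eq_zero, ← h0]
      abel
    obtain ⟨hC, -, heq⟩ := forced_equation hε hpos hw'mean hfix
    have hper := periodic_line (ψ ρ)
    -- The forcing on the branch is `ε² b h'`, while the tested pattern term is `-2π ρ b`; both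
    -- sides are proportional to `b`, so no division by `ρ` is needed.
    have henergy := energy_identity hC hper (fun x => hpos x) (continuous_line w') heq
    rw [integral_f₂_mul_deriv_mul_G r hC hper fun x => hpos x, ← obstruction_eq r hpos,
      ← hb] at henergy
    have hparts : ∫ x in (0 : ℝ)..1, w' x * deriv (fun x : ℝ => ψ ρ x) x
        = -mean (w'' * ψ ρ) :=
      integral_mul_deriv_periodic (periodic_deriv hh.periodic) hper
        (hasDerivAt_deriv_of_contDiff_two hh.contDiff) (hasDerivAt_of_contDiff_two hC)
        (continuous_deriv_deriv hh.contDiff) (contDiff_one_deriv hC).continuous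
    rw [hparts] at henergy
    have hb0 : b = 0 := by
      have : b * (ε ^ 2 * -mean (w'' * ψ ρ) + 2 * Real.pi * ρ) = 0 := by
        linear_combination -henergy
      exact (mul_eq_zero.mp this).resolve_right hcoef.ne'
    rw [hb0, zero_smul, add_zero] at hfix
    exact hfix
  -- the first-order term
  set u := deriv ψ 0 with hu
  have hψd : HasDerivAt ψ u 0 := (hψcd.differentiableAt two_ne_zero).hasDerivAt
  -- Differentiate the integral equation along the branch at `ρ = 0`; the derivative of `f₂` drops
  -- out because it carries the factor `ρ`.
  have hug : u = green (-(ε ^ 2)⁻¹ • (fderiv ℝ compf₁ w u + compf₂ r w * pattern)) := by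
    have d1 : HasDerivAt (fun ρ => compf₁ (ψ ρ)) (fderiv ℝ compf₁ w u) 0 := by
      have : HasFDerivAt compf₁ (fderiv ℝ compf₁ w) (ψ 0) := by
        rw [hψ0]
        exact ((contDiffAt_compf₁ (n := 1) hw).differentiableAt one_ne_zero).hasFDerivAt
      exact this.comp_hasDerivAt 0 hψd
    have d2 : DifferentiableAt ℝ (fun ρ => compf₂ r (ψ ρ)) 0 := by
      have : DifferentiableAt ℝ (compf₂ r) (ψ 0) := by
        rw [hψ0]
        exact (contDiffAt_compf₂ (n := 1) r hw).differentiableAt one_ne_zero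
      exact this.comp (0 : ℝ) hψd.differentiableAt
    have d3 := (hasDerivAt_id (0 : ℝ)).smul (d2.hasDerivAt.mul_const pattern)
    have d4 := ((green.hasFDerivAt.comp_hasDerivAt (0 : ℝ) (d1.add d3)).const_smul
      (ε ^ 2)⁻¹).const_sub (hbar • (1 : PeriodicMap))
    have d5 := hψd.unique (d4.congr_of_eventuallyEq hψfix)
    rw [hψ0, id_eq, zero_smul, one_smul, zero_add] at d5
    rw [map_smul, neg_smul]
    exact d5
  have hfirst : IsFirstOrderSolution r ε h fun x : ℝ => u x := by
    set g := -(ε ^ 2)⁻¹ • (fderiv ℝ compf₁ w u + compf₂ r w * pattern) with hg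
    refine ⟨⟨?_, periodic_line u, ?_⟩, fun x => ?_⟩
    · rw [hug]
      exact contDiff_green g
    · rw [← mean_apply, hug, mean_green]
    · have h1 : deriv (deriv fun x : ℝ => u x) x = g x - mean g := by
        conv_lhs => rw [hug]
        exact deriv_deriv_green g x
      have h2 : mean (fderiv ℝ compf₁ w u) = ∫ y in (0 : ℝ)..1, deriv f₁ (h y) * u y := by
        simp only [mean_apply, fderiv_compf₁_apply hw]
        rfl
      have h3 : mean (compf₂ r w * pattern) = ∫ y in (0 : ℝ)..1, f₂ r (h y) * G y := by
        simp only [mean_apply, ContinuousMap.mul_apply, compf₂_apply r hw]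
        rfl
      rw [K, h1, ← h2, ← h3, hg, map_smul, map_add, ContinuousMap.smul_apply,
        ContinuousMap.add_apply, ContinuousMap.mul_apply, fderiv_compf₁_apply hw,
        compf₂_apply r hw]
      simp only [smul_eq_mul]
      change ε ^ 2 * (-(ε ^ 2)⁻¹ * (deriv f₁ (h x) * u x + f₂ r (h x) * G x) - _) + _ - _ = _
      field_simp
      ring
  -- conclusion
  obtain ⟨C, ρ₁, hρ₁, hC⟩ := exists_taylor_bound hψcd
  obtain ⟨ρ₂, hρ₂, hfix⟩ := Metric.eventually_nhds_iff.mp (hψfix.and hψpos)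
  obtain ⟨η, hη, hball⟩ := Metric.eventually_nhds_iff.mp hψuniq
  refine ⟨_, hfirst, η / 2, by positivity, min ρ₁ (min ρ₂ η), by positivity, C,
    fun ρ x => ψ ρ x, fun ρ hρ0 hρ => ⟨fun k hk hkh => ?_, ?_, fun x => ?_⟩⟩
  · let v : PeriodicMap := ofPeriodic k hk.contDiff.continuous hk.periodic
    have hv : ∀ x, 0 < v x := pos_of_line_pos hk.pos
    have hdist : dist (ρ, v) ((0 : ℝ), w) < η := by
      rw [Prod.dist_eq]
      refine max_lt ?_ ?_
      · simpa using hρ.trans_le ((min_le_right _ _).trans (min_le_right _ _))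
      · rw [dist_eq_norm]
        exact ((norm_le_iff (by positivity)).mpr hkh).trans_lt (half_lt_self hη)
    have h1 : ψ ρ = v := hball hdist (by
      have h2 := isSteadyState_residual hε hk
      -- The stabilising term vanishes on true steady states with `ρ ≠ 0`, so the uniqueness of the
      -- implicit function applies to them.
      have h3 : obstruction r v = 0 := by
        rw [obstruction_eq r hv]
        exact hk.integral_F₂_mul_cos (abs_pos.mp hρ0)
      simp only [stabilised, h3, zero_smul, sub_zero]
      rw [sub_add, sub_eq_zero]
      exact h2)
    funext x
    exact congrArg (fun g : PeriodicMap => g x) h1.symm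
  · have h1 := hfix (y := ρ)
      (by simpa using hρ.trans_le ((min_le_right _ _).trans (min_le_left _ _)))
    exact isSteadyState_of_eq hε h1.2 h1.1
  · have h1 := hC ρ (hρ.trans_le (min_le_left _ _))
    rw [hψ0] at h1
    exact (abs_coe_le _ x).trans h1

/-! ### Steady states in a tube around the orbit -/

theorem shift_fract {h : ℝ → ℝ} (hp : Function.Periodic h 1) (s : ℝ) :
    shift h (Int.fract s) = shift h s := by
  funext x
  have := hp.int_mul ⌊s⌋ (x + Int.fract s)
  rw [mul_one, add_assoc, Int.fract_add_floor] at this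
  exact this.symm

theorem exists_bound_of_periodic {u : ℝ → ℝ} (hu : Continuous u) (hp : Function.Periodic u 1) :
    ∃ B : ℝ, 0 ≤ B ∧ ∀ x, |u x| ≤ B :=
  ⟨‖ofPeriodic u hu hp‖, norm_nonneg _, abs_coe_le (ofPeriodic u hu hp)⟩

theorem shift_ne_shift {h : ℝ → ℝ} (horbit : ∀ s ∈ Set.Ioo (0 : ℝ) 1, shift h s ≠ h) {s t : ℝ}
    (hs : s ∈ Set.Ico (0 : ℝ) 1) (ht : t ∈ Set.Ico (0 : ℝ) 1) (hst : s ≠ t) :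
    shift h s ≠ shift h t := by
  have key : ∀ {s t : ℝ}, s ∈ Set.Ico (0 : ℝ) 1 → t ∈ Set.Ico (0 : ℝ) 1 → s < t →
      shift h s ≠ shift h t := fun {s t} hs ht hst h0 =>
    horbit (t - s) ⟨by linarith, by linarith [hs.1, ht.2]⟩ <| funext fun x => by
      have := congrFun h0 (x - s)
      simp only [shift, sub_add_cancel] at this
      rw [this, shift]
      congr 1
      ring
  rcases hst.lt_or_gt with h1 | h1
  · exact key hs ht h1
  · exact (key ht hs h1).symm

/-- For small contrast, a steady state in a thin tube around the translation orbit is close to a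
point of the orbit that satisfies the solvability condition. -/
theorem exists_tube {r : Range} {ε hbar : ℝ} {h₀ : ℝ → ℝ} (hh₀ : IsSteadyState r ε hbar 0 h₀)
    {η : ℝ} (hη : 0 < η) :
    ∃ δ > 0, ∀ (ρ : ℝ) (h : ℝ → ℝ), 0 < |ρ| → |ρ| < δ → IsSteadyState r ε hbar ρ h →
      NearOrbit h₀ δ h → ∃ s ∈ Set.Ico (0 : ℝ) 1, SolvabilityCondition r (shift h₀ s) ∧
        ∀ x, |h x - shift h₀ s x| ≤ η := by
  by_contra! hcon
  choose ρ h hρ0 hρ hh hnear hfar using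
    fun n : ℕ => hcon (1 / ((n : ℝ) + 1)) Nat.one_div_pos_of_nat
  choose t ht using hnear
  -- If no tube works, pick counterexamples in tubes shrinking to the orbit; reducing their shifts
  -- modulo `1` makes a subsequence converge.
  obtain ⟨s, -, φ, hφ, hlim⟩ := isCompact_Icc.tendsto_subseq (s := Set.Icc (0 : ℝ) 1)
    (x := fun n => Int.fract (t n)) fun n => ⟨Int.fract_nonneg _, (Int.fract_lt_one _).le⟩
  obtain ⟨B, hB0, hB⟩ := exists_bound_of_periodic (contDiff_one_deriv hh₀.contDiff).continuous
    (periodic_deriv hh₀.periodic)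
  have hlip : ∀ x y, |h₀ x - h₀ y| ≤ B * |x - y| := fun x y =>
    convex_univ.norm_image_sub_le_of_norm_hasDerivWithin_le
      (fun z _ => (hasDerivAt_of_contDiff_two hh₀.contDiff z).hasDerivWithinAt)
      (fun z _ => hB z) (Set.mem_univ y) (Set.mem_univ x)
  have hbound : ∀ n x, |h (φ n) x - shift h₀ s x|
      ≤ 1 / ((φ n : ℝ) + 1) + B * |Int.fract (t (φ n)) - s| := fun n x => by
    have h1 := ht (φ n) x
    rw [← shift_fract hh₀.periodic] at h1
    have h2 := hlip (x + Int.fract (t (φ n))) (x + s)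
    rw [add_sub_add_left_eq_sub] at h2
    exact (abs_sub_le _ _ _).trans (add_le_add h1 h2)
  have htend : Filter.Tendsto
      (fun n => 1 / ((φ n : ℝ) + 1) + B * |Int.fract (t (φ n)) - s|) Filter.atTop (𝓝 0) := by
    have h1 := (tendsto_one_div_add_atTop_nhds_zero_nat (𝕜 := ℝ)).comp hφ.tendsto_atTop
    have h2 := ((hlim.sub_const s).abs).const_mul B
    simpa using h1.add h2
  have hunif : TendstoUniformly (fun n => h (φ n)) (shift h₀ s) Filter.atTop := by
    rw [Metric.tendstoUniformly_iff]
    intro κ hκ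
    filter_upwards [htend.eventually (gt_mem_nhds hκ)] with n hn x
    rw [dist_comm, Real.dist_eq]
    exact (hbound n x).trans_lt hn
  have hst := hh₀.shift s
  have hsolv := solvabilityCondition_of_tendstoUniformly hst.contDiff hst.periodic hst.pos
    (fun n => abs_pos.mp (hρ0 (φ n))) (fun n => hh (φ n)) hunif
  obtain ⟨n, hn⟩ := (htend.eventually (gt_mem_nhds hη)).exists
  -- The limit shift may equal `1`, so it is reduced modulo `1` again to contradict `hfar`.
  rw [← shift_fract hh₀.periodic] at hsolv
  obtain ⟨x, hx⟩ := hfar (φ n) (Int.fract s) ⟨Int.fract_nonneg _, Int.fract_lt_one _⟩ hsolv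
  rw [shift_fract hh₀.periodic] at hx
  linarith [hbound n x]

/-- Serves both to place a branch inside the tube and to keep the two branches apart. -/
theorem exists_near_of_expansion {h u : ℝ → ℝ} (hu : Continuous u) (hp : Function.Periodic u 1)
    (C : ℝ) {δ : ℝ} (hδ : 0 < δ) :
    ∃ ρ₀ > 0, ∀ (ρ : ℝ) (k : ℝ → ℝ), |ρ| < ρ₀ → (∀ x, |k x - h x - ρ * u x| ≤ C * ρ ^ 2) →
      ∀ x, |k x - h x| ≤ δ := by
  obtain ⟨B, hB0, hB⟩ := exists_bound_of_periodic hu hp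
  have hpos : 0 < B + |C| + 1 := by positivity
  refine ⟨min 1 (δ / (B + |C| + 1)), by positivity, fun ρ k hρ hk x => ?_⟩
  have h1 : |ρ| ≤ 1 := (hρ.trans_le (min_le_left _ _)).le
  have h2 : |ρ| * (B + |C| + 1) < δ := (lt_div_iff₀ hpos).mp (hρ.trans_le (min_le_right _ _))
  have h3 : C * ρ ^ 2 ≤ |C| * |ρ| := by
    rw [← sq_abs]
    calc C * |ρ| ^ 2 ≤ |C| * |ρ| ^ 2 := by gcongr; exact le_abs_self C
      _ ≤ |C| * |ρ| := by gcongr; nlinarith [abs_nonneg ρ]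
  have h4 : |ρ * u x| ≤ |ρ| * B := by
    rw [abs_mul]
    gcongr
    exact hB x
  have h5 : |k x - h x| ≤ |k x - h x - ρ * u x| + |ρ * u x| := by
    simpa using abs_add_le (k x - h x - ρ * u x) (ρ * u x)
  linarith [hk x, abs_nonneg ρ]

end ThinFilm

end

/-! ### Assembly of the theorem -/

open ThinFilm in
theorem mainTheorem3 (r : ThinFilm.Range) (ε hbar : ℝ) (hε : 0 < ε) (h₀ : ℝ → ℝ)
    (hh₀ : ThinFilm.IsSteadyState r ε hbar 0 h₀)
    (horbit : ∀ s ∈ Set.Ioo (0 : ℝ) 1, ThinFilm.shift h₀ s ≠ h₀) :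
    (∀ s : ℝ, ThinFilm.IsSteadyState r ε hbar 0 (ThinFilm.shift h₀ s)) ∧
    (∀ s : ℝ, (∃ u, ThinFilm.IsFirstOrderSolution r ε (ThinFilm.shift h₀ s) u) →
      ThinFilm.SolvabilityCondition r (ThinFilm.shift h₀ s)) ∧
    ∃ s₁ ∈ Set.Ico (0 : ℝ) 1, ∃ s₂ ∈ Set.Ico (0 : ℝ) 1, s₁ ≠ s₂ ∧
      (∀ s ∈ Set.Ico (0 : ℝ) 1,
        ThinFilm.SolvabilityCondition r (ThinFilm.shift h₀ s) ↔ s = s₁ ∨ s = s₂) ∧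
      (∀ s ∈ Set.Ico (0 : ℝ) 1, ∀ (ρ : ℕ → ℝ) (h : ℕ → ℝ → ℝ),
        (∀ n, ρ n ≠ 0) → Filter.Tendsto ρ Filter.atTop (𝓝 0) →
        (∀ n, ThinFilm.IsSteadyState r ε hbar (ρ n) (h n)) →
        TendstoUniformly h (ThinFilm.shift h₀ s) Filter.atTop → s = s₁ ∨ s = s₂) ∧
      (ThinFilm.Nondegenerate ε h₀ →
        (∀ s ∈ Set.Ico (0 : ℝ) 1,
          (∃ u, ThinFilm.IsFirstOrderSolution r ε (ThinFilm.shift h₀ s) u) ↔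
            s = s₁ ∨ s = s₂) ∧
        ∃ u₁ u₂ : ℝ → ℝ,
          ThinFilm.IsFirstOrderSolution r ε (ThinFilm.shift h₀ s₁) u₁ ∧
          ThinFilm.IsFirstOrderSolution r ε (ThinFilm.shift h₀ s₂) u₂ ∧
          ∃ δ > 0, ∃ ρ₀ > 0, ∃ C : ℝ, ∃ h₁ h₂ : ℝ → ℝ → ℝ,
            ∀ ρ : ℝ, 0 < |ρ| → |ρ| < ρ₀ →
              h₁ ρ ≠ h₂ ρ ∧
              (∀ h : ℝ → ℝ,
                (ThinFilm.IsSteadyState r ε hbar ρ h ∧ ThinFilm.NearOrbit h₀ δ h) ↔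
                  h = h₁ ρ ∨ h = h₂ ρ) ∧
              (∀ x, |h₁ ρ x - ThinFilm.shift h₀ s₁ x - ρ * u₁ x| ≤ C * ρ ^ 2) ∧
              (∀ x, |h₂ ρ x - ThinFilm.shift h₀ s₂ x - ρ * u₂ x| ≤ C * ρ ^ 2)) := by
  obtain ⟨x₀, a, ha, hsin⟩ := exists_solvability_sinusoid hε hh₀ horbit
  obtain ⟨s₁, hs₁, s₂, hs₂, hne, hzeros⟩ := exists_two_zeros_cos x₀
  have hsolv : ∀ s ∈ Set.Ico (0 : ℝ) 1,
      SolvabilityCondition r (shift h₀ s) ↔ s = s₁ ∨ s = s₂ := fun s hs => by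
    rw [SolvabilityCondition, (hsin s).1, ← hzeros s hs]
    simp [ha]
  refine ⟨hh₀.shift, fun s ⟨u, hu⟩ =>
    solvabilityCondition_of_isFirstOrderSolution (hh₀.shift s) hu,
    s₁, hs₁, s₂, hs₂, hne, hsolv, fun s hs ρ h hρ _ hh hlim => (hsolv s hs).mp ?_, fun hn => ?_⟩
  · have hst := hh₀.shift s
    exact solvabilityCondition_of_tendstoUniformly hst.contDiff hst.periodic hst.pos hρ hh hlim
  have hbranch : ∀ s ∈ Set.Ico (0 : ℝ) 1, (s = s₁ ∨ s = s₂) → _ := fun s hs hs' =>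
    exists_unique_branch hε (hh₀.shift s) (hn.shift hh₀.periodic s) ((hsolv s hs).mpr hs') (by
      rw [(hsin s).2]
      -- The zeros are simple: sine and cosine do not vanish together.
      refine mul_ne_zero ha fun h0 => ?_
      have h1 := Real.sin_sq_add_cos_sq (2 * Real.pi * (s - x₀))
      rw [h0, (hzeros s hs).mpr hs'] at h1
      norm_num at h1)
  obtain ⟨u₁, hu₁, η₁, hη₁, ρ₁, hρ₁, C₁, H₁, hH₁⟩ := hbranch s₁ hs₁ (Or.inl rfl)
  obtain ⟨u₂, hu₂, η₂, hη₂, ρ₂, hρ₂, C₂, H₂, hH₂⟩ := hbranch s₂ hs₂ (Or.inr rfl)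
  refine ⟨fun s hs => ⟨fun ⟨u, hu⟩ => (hsolv s hs).mp
    (solvabilityCondition_of_isFirstOrderSolution (hh₀.shift s) hu), ?_⟩, u₁, u₂, hu₁, hu₂, ?_⟩
  · rintro (rfl | rfl)
    exacts [⟨u₁, hu₁⟩, ⟨u₂, hu₂⟩]
  -- A radius below both `η₁` and `η₂` makes every steady state in the tube subject to the
  -- uniqueness of one of the two branches.
  obtain ⟨δ, hδ, htube⟩ := exists_tube hh₀ (lt_min hη₁ hη₂)
  obtain ⟨x, hx⟩ := Function.ne_iff.mp (shift_ne_shift horbit hs₁ hs₂ hne)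
  have hgap : 0 < |shift h₀ s₁ x - shift h₀ s₂ x| := abs_pos.mpr (sub_ne_zero.mpr hx)
  set d := |shift h₀ s₁ x - shift h₀ s₂ x| with hd
  -- Closeness `δ` puts the branches in the tube; `d / 3` separates them, since a common value at
  -- `x` would give `d ≤ 2 * d / 3`.
  have hκ : 0 < min δ (d / 3) := by positivity
  obtain ⟨ρ₃, hρ₃, hnear₁⟩ := exists_near_of_expansion (h := shift h₀ s₁)
    hu₁.1.contDiff.continuous hu₁.1.periodic C₁ hκ
  obtain ⟨ρ₄, hρ₄, hnear₂⟩ := exists_near_of_expansion (h := shift h₀ s₂)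
    hu₂.1.contDiff.continuous hu₂.1.periodic C₂ hκ
  refine ⟨δ, hδ, min (min ρ₁ ρ₂) (min δ (min ρ₃ ρ₄)), by positivity, max C₁ C₂, H₁, H₂,
    fun ρ hρ0 hρ => ?_⟩
  simp only [lt_min_iff] at hρ
  obtain ⟨⟨hlt₁, hlt₂⟩, hltδ, hlt₃, hlt₄⟩ := hρ
  obtain ⟨huniq₁, hst₁, hexp₁⟩ := hH₁ ρ hρ0 hlt₁
  obtain ⟨huniq₂, hst₂, hexp₂⟩ := hH₂ ρ hρ0 hlt₂
  have hclose₁ := hnear₁ ρ (H₁ ρ) hlt₃ hexp₁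
  have hclose₂ := hnear₂ ρ (H₂ ρ) hlt₄ hexp₂
  refine ⟨fun heq => ?_, fun h => ⟨fun ⟨hh, hno⟩ => ?_, ?_⟩, fun y => ?_, fun y => ?_⟩
  · have h1 := (hclose₁ x).trans (min_le_right _ _)
    have h2 := (hclose₂ x).trans (min_le_right _ _)
    rw [heq, abs_sub_comm] at h1
    have h3 := abs_sub_le (shift h₀ s₁ x) (H₂ ρ x) (shift h₀ s₂ x)
    linarith
  · obtain ⟨s, hs, hsc, hclose⟩ := htube ρ h hρ0 hltδ hh hno
    rcases (hsolv s hs).mp hsc with rfl | rfl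
    · exact Or.inl (huniq₁ h hh fun y => (hclose y).trans (min_le_left _ _))
    · exact Or.inr (huniq₂ h hh fun y => (hclose y).trans (min_le_right _ _))
  · rintro (rfl | rfl)
    · exact ⟨hst₁, s₁, fun y => (hclose₁ y).trans (min_le_left _ _)⟩
    · exact ⟨hst₂, s₂, fun y => (hclose₂ y).trans (min_le_left _ _)⟩
  · exact (hexp₁ y).trans (mul_le_mul_of_nonneg_right (le_max_left _ _) (sq_nonneg _))
  · exact (hexp₂ y).trans (mul_le_mul_of_nonneg_right (le_max_right _ _) (sq_nonneg _))
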